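/- Let $\mathbb T^3=(\mathbb R/2\pi\mathbb Z)^3$ and, for a (scalar or vector valued) function $v$ on $\mathbb T^3$, let $\|v\|_{\dot B^{-1}_{\infty,\infty}}=\sup_{s>0}s^{1/2}\|e^{s\Delta}v\|_{L^\infty(\mathbb T^3)}$. Fix a viscosity $\nu>0$. By a solution on $[0,T]$ of the Navier–Stokes equations $$\partial_t u+u\cdot\nabla u+\nabla P=\nu\Delta u,\qquad \operatorname{div}u=0,\qquad u(0,\cdot)=u_{0}\qquad\text{on }\mathbb T^3$$ we mean $u\in C([0,T]\times\mathbb T^3)\cap C^\infty((0,T]\times\mathbb T^3)$ that attains the datum $u_0$ at $t=0$ and satisfies the equations on $(0,T]\times\mathbb T^3$ with some pressure $P\in C^\infty((0,T]\times\mathbb T^3)$. Theorem (strong symmetry breaking). For every $0<\delta<1$ there exist mean-free, divergence-free vector fields $u_{\rm in},\bar u_{\rm in}\in C^\infty(\mathbb T^3;\mathbb R^3)$ with vanishing third component such that $\bar u_{\rm in}$ is a 2.75D shear datum, i.e. $$\bar u_{\rm in}(x)=\bigl(f(\lambda x_1+x_2,x_3),\,-\lambda f(\lambda x_1+x_2,x_3)-g(x_3),\,0\bigr)$$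 for some $\lambda\in\mathbb Z$, $f\in C^\infty(\mathbb T^2;\mathbb R)$, $g\in C^\infty(\mathbb T;\mathbb R)$, and such that, writing $v^{\rm h}=(v^1,v^2)$, $$\|u_{\rm in}-\bar u_{\rm in}\|_{\dot B^{-1}_{\infty,\infty}}=\|u_{\rm in}^{\rm h}-\bar u_{\rm in}^{\rm h}\|_{\dot B^{-1}_{\infty,\infty}}<\delta ,$$ and there is a time $0<T<\delta$ for which the following holds. There exist a unique solution $u$ on $[0,T]$ with datum $u_{\rm in}$ and a unique solution $\bar u$ on $[0,T]$ with datum $\bar u_{\rm in}$; moreover $\bar u^3\equiv0$ on $[0,T]\times\mathbb T^3$, $$\|u^3(T,\cdot)-\bar u^3(T,\cdot)\|_{\dot B^{-1}_{\infty,\infty}}=\|u^3(T,\cdot)\|_{\dot B^{-1}_{\infty,\infty}}>\frac1\delta ,$$ and $$\min\bigl(\|u^1(T,\cdot)\|_{L^3(\mathbb T^3)},\|u^2(T,\cdot)\|_{L^3(\mathbb T^3)},\|u^3(T,\cdot)\|_{L^3(\mathbb T^3)}\bigr)>\frac1\delta .$$ -/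

import Mathlib

open MeasureTheory Set
open scoped ContDiff ENNReal

noncomputable section

namespace NSTorus

/-- Euclidean space `ℝ³`, coordinates `0, 1, 2` standing for `x₁, x₂, x₃`. Functions on the torus
`𝕋³ = (ℝ / 2πℤ)³` are functions on `ℝ³` that are `2π`-periodic in every coordinate. -/
abbrev E3 : Type := EuclideanSpace ℝ (Fin 3)

/-- `i`-th canonical basis vector of `ℝ³`. -/
def e (i : Fin 3) : E3 := EuclideanSpace.single i 1

/-- `v` is a function on the torus `(ℝ / 2πℤ)³`. -/
def IsPeriodic {F : Type*} (v : E3 → F) : Prop :=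
  ∀ (x : E3) (i : Fin 3), v (x + (2 * Real.pi) • e i) = v x

/-- A fundamental domain `[0, 2π)³` of the torus. -/
def cell : Set E3 := {x | ∀ i, x i ∈ Ico (0 : ℝ) (2 * Real.pi)}

/-- Vanishing mean over the torus. -/
def IsMeanFree (v : E3 → E3) : Prop := ∫ x in cell, v x = 0

/-- Divergence of a vector field on `ℝ³`. -/
def divergence (v : E3 → E3) (x : E3) : ℝ := ∑ i, (fderiv ℝ v x (e i)) i

/-- The horizontal part `v^h = (v¹, v²)` of a vector field. -/
def horizontal (v : E3 → E3) (x : E3) : EuclideanSpace ℝ (Fin 2) := !₂[v x 0, v x 1]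

/-- The Gaussian heat kernel on `ℝ³`. -/
def heatKernel (s : ℝ) (y : E3) : ℝ :=
  (4 * Real.pi * s) ^ (-(3 / 2) : ℝ) * Real.exp (-‖y‖ ^ 2 / (4 * s))

/-- The heat semigroup `e^{sΔ} v` for `s > 0`; convolution of a periodic function with the
Gaussian on `ℝ³` is the heat semigroup of the torus. -/
def heat {F : Type*} [NormedAddCommGroup F] [NormedSpace ℝ F] (s : ℝ) (v : E3 → F) (x : E3) : F :=
  ∫ y, heatKernel s y • v (x - y)

/-- The norm `sup_{s > 0} s^{1/2} ‖e^{sΔ} v‖_{L^∞}` of the homogeneous Besov space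
`Ḃ^{-1}_{∞,∞}`, for scalar or vector-valued periodic `v`. -/
def besovNorm {F : Type*} [NormedAddCommGroup F] [NormedSpace ℝ F] (v : E3 → F) : ℝ≥0∞ :=
  ⨆ (s : ℝ) (_ : 0 < s), ENNReal.ofReal (Real.sqrt s) * eLpNorm (heat s v) ∞ volume

/-- The `L³` norm on the torus. -/
def L3Norm (v : E3 → ℝ) : ℝ≥0∞ := eLpNorm v 3 (volume.restrict cell)

/-- Smooth, mean-free, divergence-free initial data on the torus with zero third component. -/
structure IsDatum (v : E3 → E3) : Prop where
  smooth : ContDiff ℝ ∞ v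
  periodic : IsPeriodic v
  meanFree : IsMeanFree v
  divFree : ∀ x, divergence v x = 0
  third : ∀ x, v x 2 = 0

/-- 2.75D shear data
`(f(λ x₁ + x₂, x₃), -λ f(λ x₁ + x₂, x₃) - g(x₃), 0)` with `λ ∈ ℤ` and smooth `2π`-periodic
profiles `f : 𝕋² → ℝ` and `g : 𝕋 → ℝ`. -/
def IsShearDatum (v : E3 → E3) : Prop :=
  ∃ (l : ℤ) (f : ℝ → ℝ → ℝ) (g : ℝ → ℝ),
    ContDiff ℝ ∞ (fun p : ℝ × ℝ => f p.1 p.2) ∧ ContDiff ℝ ∞ g ∧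
    (∀ a b, f (a + 2 * Real.pi) b = f a b) ∧ (∀ a b, f a (b + 2 * Real.pi) = f a b) ∧
    (∀ b, g (b + 2 * Real.pi) = g b) ∧
    ∀ x : E3, v x =
      !₂[f (l * x 0 + x 1) (x 2), -(l : ℝ) * f (l * x 0 + x 1) (x 2) - g (x 2), 0]

/-- `u` is a solution on `[0, T] × 𝕋³`, continuous there and smooth on `(0, T] × 𝕋³`, of
`∂ₜ u + u · ∇ u + ∇ P = ν Δ u`, `div u = 0`, `u(0) = u₀`, for some periodic pressure `P`
smooth on `(0, T] × 𝕋³`. -/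
structure IsNSSolution (ν T : ℝ) (u₀ : E3 → E3) (u : ℝ → E3 → E3) : Prop where
  cont : ContinuousOn (fun p : ℝ × E3 => u p.1 p.2) (Icc 0 T ×ˢ univ)
  smooth : ContDiffOn ℝ ∞ (fun p : ℝ × E3 => u p.1 p.2) (Ioc 0 T ×ˢ univ)
  periodic : ∀ t ∈ Icc 0 T, IsPeriodic (u t)
  initial : u 0 = u₀
  divFree : ∀ t ∈ Ioc 0 T, ∀ x, divergence (u t) x = 0
  momentum : ∃ P : ℝ → E3 → ℝ,
    ContDiffOn ℝ ∞ (fun p : ℝ × E3 => P p.1 p.2) (Ioc 0 T ×ˢ univ) ∧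
    (∀ t ∈ Ioc 0 T, IsPeriodic (P t)) ∧
    ∀ t ∈ Ioc 0 T, ∀ x,
      derivWithin (fun τ => u τ x) (Ioc 0 T) t + fderiv ℝ (u t) x (u t x) + gradient (P t) x
        = ν • Laplacian.laplacian (u t) x

/-- `u` is the unique solution on `[0, T] × 𝕋³` with initial data `u₀`. -/
def IsUniqueNSSolution (ν T : ℝ) (u₀ : E3 → E3) (u : ℝ → E3 → E3) : Prop :=
  IsNSSolution ν T u₀ u ∧
    ∀ w : ℝ → E3 → E3, IsNSSolution ν T u₀ w → ∀ t ∈ Icc 0 T, w t = u t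

end NSTorus

end

/-! The data are built from two crossing sine shears. The wave vectors `kBase = (-N, 1, 1)` and
`kPert = (N, 1, 1)` have equal length, `ubin` is the shear `A sin ⟪kBase, x⟫ dBase`, and `uin` adds
the shear `B sin ⟪kPert, x⟫ dPert` with `B = δ / 2`. Both have no third component, and the added
shear has Besov norm at most `B`, since its wave number and its direction have the same order `N`.

Everything is invariant along `dInv = (0, 1, -1)`, so the flow is 2.5-dimensional. Transverse to
`dInv` the velocity has a stream function that is an eigenfunction of the Laplacian, hence is a
steady Euler flow which viscosity merely damps; the remaining part of the nonlinearity is parallel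
to `dInv`. The exact solution with datum `uin` is therefore
`exp (-ν (N² + 2) t) • crossShear N A B + ζ • dInv` (`IsResponse.isNSSolution_flow`), where the
scalar `ζ` solves a linear advection-diffusion equation with a source `N² A B sin (2 (x₂ + x₃))`.
The source has low frequency, while `uin - ubin` has frequency `N`; this is what makes the third
component `-ζ` large although the perturbation is small in the Besov norm. Without the
perturbation there is no source, and the third component stays zero.

The equation for `ζ` is solved by a sine series in the phases `⟪kBase, x⟫` and `⟪kPert, x⟫`. Its
coefficients satisfy an infinite linear system, solved by contraction in a space with exponential
weights whose rate decreases in time (`exists_coeff`); the series is smooth because time derivatives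
can be read off from the system (`smoothDecay_of_forcing`, `contDiffOn_sineSeries`). The same
contraction shows that `ζ` is `N² A B t sin (2 (x₂ + x₃))`, up to viscosity and a relative error of
order `N A t` (`exists_isResponse`). With `N² A B T = 100 / δ` this error is of order `1 / (N B δ)`,
so `N` is chosen large, and then `A` large, which makes `T` and the effect of viscosity small and
the horizontal components large (`exists_parameters`).

The velocity gradient of this solution is bounded, so the energy estimate for the difference with
any other solution gives uniqueness (`IsNSSolution.unique`). -/

noncomputable section

namespace NSTorus

/-! ### Integration by parts on the torus -/

lemma e_eq_basisFun (i : Fin 3) : e i = EuclideanSpace.basisFun (Fin 3) ℝ i := by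
  simp [e]

/-- The closed fundamental domain `[0, 2π]³`. -/
def closedCell : Set E3 := {x | ∀ i, x i ∈ Icc (0 : ℝ) (2 * Real.pi)}

lemma cell_eq_preimage :
    cell = (WithLp.ofLp : E3 → Fin 3 → ℝ) ⁻¹' (univ.pi fun _ => Ico (0 : ℝ) (2 * Real.pi)) := by
  ext x; simp [cell]

lemma closedCell_eq_preimage :
    closedCell = (WithLp.ofLp : E3 → Fin 3 → ℝ) ⁻¹' (Icc 0 (fun _ => 2 * Real.pi)) := by
  ext x; simp [closedCell, ← pi_univ_Icc]

lemma measurableSet_cell : MeasurableSet cell := by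
  rw [cell_eq_preimage]
  exact (MeasurableSet.univ_pi fun _ => measurableSet_Ico).preimage
    (PiLp.volume_preserving_ofLp (Fin 3)).measurable

lemma isCompact_closedCell : IsCompact closedCell := by
  rw [closedCell_eq_preimage]
  exact (PiLp.homeomorph 2 (fun _ : Fin 3 => ℝ)).isCompact_preimage.2 isCompact_Icc

lemma cell_subset_closedCell : cell ⊆ closedCell := fun _ hx i => Ico_subset_Icc_self (hx i)

lemma cell_ae_eq_closedCell : cell =ᵐ[volume] closedCell := by
  rw [cell_eq_preimage, closedCell_eq_preimage]
  refine (PiLp.volume_preserving_ofLp (Fin 3)).quasiMeasurePreserving.preimage_ae_eq ?_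
  exact Measure.univ_pi_Ico_ae_eq_Icc (f := fun _ => (0 : ℝ))

lemma volume_cell_lt_top : volume cell < ⊤ :=
  (measure_mono cell_subset_closedCell).trans_lt isCompact_closedCell.measure_lt_top

instance isFiniteMeasure_cell : IsFiniteMeasure (volume.restrict cell) :=
  ⟨by simpa using volume_cell_lt_top⟩

lemma integrableOn_cell {F : Type*} [NormedAddCommGroup F] {f : E3 → F} (hf : Continuous f) :
    IntegrableOn f cell :=
  (hf.continuousOn.integrableOn_compact isCompact_closedCell).mono_set cell_subset_closedCell

/-- The divergence of a periodic `C¹` field integrates to zero over the torus. -/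
lemma integral_cell_sum_fderiv_eq_zero {F : Type*} [NormedAddCommGroup F] [NormedSpace ℝ F]
    [CompleteSpace F] (G : Fin 3 → E3 → F) (hG : ∀ i, ContDiff ℝ 1 (G i))
    (hper : ∀ i, IsPeriodic (G i)) :
    ∫ x in cell, ∑ i, fderiv ℝ (G i) x (e i) = 0 := by
  let L : E3 ≃L[ℝ] (Fin 3 → ℝ) := PiLp.continuousLinearEquiv 2 ℝ (fun _ : Fin 3 => ℝ)
  have hemb : MeasurableEmbedding (WithLp.ofLp : E3 → Fin 3 → ℝ) :=
    L.toHomeomorph.measurableEmbedding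
  have hL : ∀ i, L.symm (Pi.single i 1) = e i := by
    intro i; ext j; simp [L, e]
  have hcont : Continuous fun x : E3 => ∑ i, fderiv ℝ (G i) x (e i) :=
    continuous_finsetSum _ fun i _ => ((hG i).continuous_fderiv one_ne_zero).clm_apply
      continuous_const
  rw [setIntegral_congr_set cell_ae_eq_closedCell, closedCell_eq_preimage]
  have h1 := (PiLp.volume_preserving_ofLp (Fin 3)).setIntegral_preimage_emb hemb
    (fun y => ∑ i, fderiv ℝ (G i) (L.symm y) (e i)) (Icc 0 (fun _ => 2 * Real.pi))
  have h2 : ∀ x : E3, L.symm (WithLp.ofLp x) = x := fun x => L.symm_apply_apply x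
  simp only [h2] at h1
  have h3 := integral_divergence_of_hasFDerivAt_off_countable' (n := 2)
    (0 : Fin 3 → ℝ) (fun _ => 2 * Real.pi) (fun _ => by simpa using Real.pi_pos.le)
    (fun i y => G i (L.symm y)) (fun i y => (fderiv ℝ (G i) (L.symm y)) ∘L (L.symm : _ →L[ℝ] E3))
    ∅ countable_empty (fun i => ((hG i).continuous.comp L.symm.continuous).continuousOn)
    (fun x _ i => (((hG i).differentiable one_ne_zero) _).hasFDerivAt.comp x L.symm.hasFDerivAt)
    ((Continuous.continuousOn (by
      simp only [ContinuousLinearMap.comp_apply, ContinuousLinearEquiv.coe_coe, hL]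
      exact hcont.comp L.symm.continuous)).integrableOn_compact isCompact_Icc)
  simp only [ContinuousLinearMap.comp_apply, ContinuousLinearEquiv.coe_coe, hL] at h3
  refine h1.trans (h3.trans ?_)
  refine Finset.sum_eq_zero fun i _ => sub_eq_zero.2 ?_
  congr 1
  ext y
  have h4 : L.symm (i.insertNth (2 * Real.pi) y)
      = L.symm (i.insertNth 0 y) + (2 * Real.pi) • e i := by
    rw [← hL, ← map_smul, ← map_add]
    congr 1
    ext j
    refine Fin.succAboveCases i ?_ (fun j => ?_) j <;> simp
  simpa [h4] using hper i (L.symm (i.insertNth 0 y)) i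

/-- The Laplacian in the standard coordinates. -/
lemma laplacian_eq_sum {F : Type*} [NormedAddCommGroup F] [NormedSpace ℝ F] {f : E3 → F}
    (hf : ContDiff ℝ 2 f) (x : E3) :
    Laplacian.laplacian f x = ∑ i, fderiv ℝ (fun y => fderiv ℝ f y (e i)) x (e i) := by
  rw [InnerProductSpace.laplacian_eq_iteratedFDeriv_orthonormalBasis f
    (EuclideanSpace.basisFun (Fin 3) ℝ)]
  refine Finset.sum_congr rfl fun i _ => ?_
  rw [iteratedFDeriv_two_apply, e_eq_basisFun]
  have : DifferentiableAt ℝ (fderiv ℝ f) x :=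
    ((hf.fderiv_right (m := 1) (by norm_num)).differentiable one_ne_zero) x
  rw [fderiv_clm_apply this (differentiableAt_const _)]
  simp

lemma IsPeriodic.fderiv {F : Type*} [NormedAddCommGroup F] [NormedSpace ℝ F] {f : E3 → F}
    (hf : IsPeriodic f) : IsPeriodic (fderiv ℝ f) := by
  intro x i
  have h : (fun y => f (y + (2 * Real.pi) • e i)) = f := funext fun y => hf y i
  rw [← fderiv_comp_add_right, h]

/-- Pointwise energy identity: the flux of kinetic energy of a field `D` transported by a
divergence-free field `w`, with pressure `p` and viscosity `ν`. -/
lemma sum_fderiv_energyFlux {w D : E3 → E3} {p : E3 → ℝ} (ν : ℝ) (hw : ContDiff ℝ 1 w)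
    (hD : ContDiff ℝ 2 D) (hp : ContDiff ℝ 1 p) (hdw : ∀ x, divergence w x = 0)
    (hdD : ∀ x, divergence D x = 0) (x : E3) :
    ∑ i, fderiv ℝ (fun y => ν * inner ℝ (D y) (fderiv ℝ D y (e i))
        - w y i * (1 / 2 * ‖D y‖ ^ 2) - p y * D y i) x (e i)
      = ν * inner ℝ (D x) (Laplacian.laplacian D x) + ν * ∑ i, ‖fderiv ℝ D x (e i)‖ ^ 2
        - inner ℝ (D x) (fderiv ℝ D x (w x)) - inner ℝ (D x) (gradient p x) := by
  have hD1 : HasFDerivAt D (fderiv ℝ D x) x := (hD.differentiable two_ne_zero x).hasFDerivAt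
  have hw1 : HasFDerivAt w (fderiv ℝ w x) x := (hw.differentiable one_ne_zero x).hasFDerivAt
  have hp1 : HasFDerivAt p (fderiv ℝ p x) x := (hp.differentiable one_ne_zero x).hasFDerivAt
  have hDD : ∀ i, HasFDerivAt (fun y => fderiv ℝ D y (e i))
      (fderiv ℝ (fun y => fderiv ℝ D y (e i)) x) x := fun i =>
    ((((hD.fderiv_right (m := 1) (by norm_num)).clm_apply contDiff_const).differentiable
      one_ne_zero) x).hasFDerivAt
  have hco : ∀ {f : E3 → E3} {f' : E3 →L[ℝ] E3} (i : Fin 3), HasFDerivAt f f' x →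
      HasFDerivAt (fun y => f y i) ((EuclideanSpace.proj i : E3 →L[ℝ] ℝ) ∘L f') x := by
    intro f f' i h
    exact (EuclideanSpace.proj i : E3 →L[ℝ] ℝ).hasFDerivAt.comp x h
  have key : ∀ i, fderiv ℝ (fun y => ν * inner ℝ (D y) (fderiv ℝ D y (e i))
        - w y i * (1 / 2 * ‖D y‖ ^ 2) - p y * D y i) x (e i)
      = ν * inner ℝ (D x) (fderiv ℝ (fun y => fderiv ℝ D y (e i)) x (e i))
        + ν * ‖fderiv ℝ D x (e i)‖ ^ 2 - w x i * inner ℝ (D x) (fderiv ℝ D x (e i))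
        - ‖D x‖ ^ 2 / 2 * (fderiv ℝ w x (e i)) i - D x i * fderiv ℝ p x (e i)
        - p x * (fderiv ℝ D x (e i)) i := by
    intro i
    have h := (((hD1.inner ℝ (hDD i)).const_mul ν).sub
      ((hco i hw1).mul (hD1.norm_sq.const_mul (1 / 2)))).sub (hp1.mul (hco i hD1))
    refine (congrArg (fun L : E3 →L[ℝ] ℝ => L (e i)) h.fderiv).trans ?_
    simp
    ring
  have hsum : ∀ y : E3, y = ∑ i, y i • e i := fun y => by
    ext j; fin_cases j <;> simp [Fin.sum_univ_three, e]
  have hlin : inner ℝ (D x) (fderiv ℝ D x (w x))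
      = ∑ i, w x i * inner ℝ (D x) (fderiv ℝ D x (e i)) := by
    conv_lhs => rw [hsum (w x)]
    simp [inner_sum, inner_smul_right]
  have hgrad : inner ℝ (D x) (gradient p x) = ∑ i, D x i * fderiv ℝ p x (e i) := by
    rw [real_inner_comm, gradient, InnerProductSpace.toDual_symm_apply]
    conv_lhs => rw [hsum (D x)]
    simp
  simp only [key, Finset.sum_sub_distrib, Finset.sum_add_distrib, ← Finset.mul_sum]
  rw [hlin, hgrad, laplacian_eq_sum hD, inner_sum]
  have h1 := hdw x
  have h2 := hdD x
  simp only [divergence] at h1 h2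
  rw [h1, h2]
  ring

/-! ### Differentiation under the integral over the torus -/

lemma continuousOn_integral_cell {g : ℝ → E3 → ℝ} {T : ℝ}
    (hg : ContinuousOn (fun p : ℝ × E3 => g p.1 p.2) (Icc 0 T ×ˢ univ)) :
    ContinuousOn (fun t => ∫ x in cell, g t x) (Icc 0 T) := by
  obtain ⟨C, hC⟩ := (isCompact_Icc.prod isCompact_closedCell).exists_bound_of_continuousOn
    (hg.mono (prod_mono_right (subset_univ closedCell)))
  have hslice : ∀ t ∈ Icc 0 T, Continuous (g t) := fun t ht =>
    continuousOn_univ.1 (hg.comp (f := fun x => (t, x)) (by fun_prop) fun x _ => ⟨ht, mem_univ x⟩)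
  refine continuousOn_of_dominated (bound := fun _ => C) ?_ ?_ (integrable_const C) ?_
  · exact fun t ht => (hslice t ht).aestronglyMeasurable
  · intro t ht
    filter_upwards [ae_restrict_mem measurableSet_cell] with x hx
    exact hC (t, x) ⟨ht, cell_subset_closedCell hx⟩
  · refine ae_of_all _ fun x => hg.comp (f := fun t => (t, x)) (by fun_prop) fun t ht => ?_
    exact ⟨ht, mem_univ x⟩

lemma hasDerivAt_integral_cell {g : ℝ → E3 → ℝ} {T t : ℝ} (ht : t ∈ Ioo 0 T)
    (hg : ContDiffOn ℝ 1 (fun p : ℝ × E3 => g p.1 p.2) (Ioo 0 T ×ˢ univ)) :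
    IntegrableOn (fun x => deriv (fun τ => g τ x) t) cell ∧
      HasDerivAt (fun t => ∫ x in cell, g t x) (∫ x in cell, deriv (fun τ => g τ x) t) t := by
  set G : ℝ × E3 → ℝ := fun p => g p.1 p.2
  have hopen : IsOpen (Ioo 0 T ×ˢ (univ : Set E3)) := isOpen_Ioo.prod isOpen_univ
  have hd : ∀ τ ∈ Ioo 0 T, ∀ x, HasDerivAt (fun s => g s x) (fderiv ℝ G (τ, x) (1, 0)) τ := by
    intro τ hτ x
    have h1 : HasFDerivAt G (fderiv ℝ G (τ, x)) (τ, x) :=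
      ((hg.differentiableOn one_ne_zero).differentiableAt
        (hopen.mem_nhds ⟨hτ, mem_univ x⟩)).hasFDerivAt
    exact h1.comp_hasDerivAt τ ((hasDerivAt_id τ).prodMk (hasDerivAt_const τ x))
  have hcont : ContinuousOn (fun p : ℝ × E3 => fderiv ℝ G p (1, 0)) (Ioo 0 T ×ˢ univ) :=
    (hg.continuousOn_fderiv_of_isOpen hopen le_rfl).clm_apply continuousOn_const
  have hslice : ∀ τ ∈ Ioo 0 T, Continuous (g τ) := fun τ hτ =>
    continuousOn_univ.1 (hg.continuousOn.comp (f := fun x => (τ, x)) (by fun_prop)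
      fun x _ => ⟨hτ, mem_univ x⟩)
  obtain ⟨a, b, hab, hsub⟩ : ∃ a b, t ∈ Ioo a b ∧ Icc a b ⊆ Ioo 0 T :=
    ⟨t / 2, (t + T) / 2, ⟨by linarith [ht.1], by linarith [ht.2]⟩,
      fun s hs => ⟨by linarith [hs.1, ht.1], by linarith [hs.2, ht.2]⟩⟩
  obtain ⟨C, hC⟩ := ((isCompact_Icc (a := a) (b := b)).prod
    isCompact_closedCell).exists_bound_of_continuousOn
    (hcont.mono (prod_mono hsub (subset_univ closedCell)))
  have hmeas : Continuous fun x => fderiv ℝ G (t, x) (1, 0) :=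
    continuousOn_univ.1 (hcont.comp (f := fun x => (t, x)) (by fun_prop)
      fun x _ => ⟨ht, mem_univ x⟩)
  have h := (hasDerivAt_integral_of_dominated_loc_of_deriv_le (μ := volume.restrict cell)
    (F := g) (F' := fun τ x => fderiv ℝ G (τ, x) (1, 0)) (bound := fun _ => C)
    (Icc_mem_nhds hab.1 hab.2)
    (by
      filter_upwards [Ioo_mem_nhds ht.1 ht.2] with τ hτ
      exact (hslice τ hτ).aestronglyMeasurable)
    (integrableOn_cell (hslice t ht)) hmeas.aestronglyMeasurable
    (by
      filter_upwards [ae_restrict_mem measurableSet_cell] with x hx τ hτ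
      exact hC (τ, x) ⟨hτ, cell_subset_closedCell hx⟩)
    (integrable_const C)
    (ae_of_all _ fun x τ hτ => hd τ (hsub hτ) x))
  simpa only [(hd t ht _).deriv, IntegrableOn] using h

/-! ### Uniqueness -/

lemma IsNSSolution.contDiff_slice {ν T : ℝ} {u₀ : E3 → E3} {u : ℝ → E3 → E3}
    (hu : IsNSSolution ν T u₀ u) {t : ℝ} (ht : t ∈ Ioc 0 T) : ContDiff ℝ ∞ (u t) :=
  contDiffOn_univ.1 (hu.smooth.comp (f := fun x => (t, x)) (by fun_prop)
    fun x _ => ⟨ht, mem_univ x⟩)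

lemma IsNSSolution.hasDerivAt {ν T : ℝ} {u₀ : E3 → E3} {u : ℝ → E3 → E3}
    (hu : IsNSSolution ν T u₀ u) {t : ℝ} (ht : t ∈ Ioo 0 T) (x : E3) :
    HasDerivAt (fun τ => u τ x) (derivWithin (fun τ => u τ x) (Ioc 0 T) t) t := by
  have hn : Ioc 0 T ∈ nhds t := Ioc_mem_nhds ht.1 ht.2
  rw [derivWithin_of_mem_nhds hn]
  have h1 : ContDiffAt ℝ ∞ (fun p : ℝ × E3 => u p.1 p.2) (t, x) :=
    hu.smooth.contDiffAt (prod_mem_nhds hn Filter.univ_mem)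
  have h2 : ContDiffAt ℝ ∞ (fun τ => u τ x) t :=
    h1.comp (f := fun τ => (τ, x)) t (by fun_prop)
  exact (h2.differentiableAt (by simp)).hasDerivAt

lemma IsPeriodic.exists_mem_cell {F : Type*} {f : E3 → F} (hf : IsPeriodic f) (x : E3) :
    ∃ y ∈ cell, f y = f x := by
  have hp : ∀ i, Function.Periodic f ((2 * Real.pi) • e i) := fun i y => hf y i
  let n : Fin 3 → ℤ := fun i => ⌊x i / (2 * Real.pi)⌋
  refine ⟨x - n 0 • ((2 * Real.pi) • e 0) - n 1 • ((2 * Real.pi) • e 1)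
    - n 2 • ((2 * Real.pi) • e 2), ?_, ?_⟩
  · have h : ∀ i, x i - n i * (2 * Real.pi) ∈ Ico 0 (2 * Real.pi) := fun i => by
      have h2 : 0 < 2 * Real.pi := by positivity
      have h3 : x i = x i / (2 * Real.pi) * (2 * Real.pi) := by field_simp
      have h4 := mul_le_mul_of_nonneg_right (Int.floor_le (x i / (2 * Real.pi))) h2.le
      have h5 := mul_lt_mul_of_pos_right (Int.lt_floor_add_one (x i / (2 * Real.pi))) h2
      constructor <;> simp only [n] <;> linarith
    intro i
    fin_cases i
    · simpa [e] using h 0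
    · simpa [e] using h 1
    · simpa [e] using h 2
  · rw [(hp 2).sub_zsmul_eq, (hp 1).sub_zsmul_eq, (hp 0).sub_zsmul_eq]

/-- A continuous nonnegative periodic function whose integral over the torus vanishes is zero. -/
lemma eq_zero_of_integral_cell_eq_zero {f : E3 → ℝ} (hf : Continuous f) (hf0 : ∀ x, 0 ≤ f x)
    (hper : IsPeriodic f) (h : ∫ x in cell, f x = 0) (x : E3) : f x = 0 := by
  have h1 : f =ᵐ[volume.restrict cell] 0 :=
    (integral_eq_zero_iff_of_nonneg hf0 (integrableOn_cell hf)).1 h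
  rw [Measure.restrict_congr_set cell_ae_eq_closedCell] at h1
  have hcl : closedCell ⊆ closure (interior closedCell) := by
    have h2 : closedCell = (PiLp.homeomorph 2 (fun _ : Fin 3 => ℝ)) ⁻¹'
        (Icc 0 (fun _ => 2 * Real.pi)) := closedCell_eq_preimage
    rw [h2, ← Homeomorph.preimage_interior, ← Homeomorph.preimage_closure, ← pi_univ_Icc,
      interior_pi_set finite_univ]
    simp only [interior_Icc, closure_pi_set, Pi.zero_apply]
    rw [closure_Ioo (by simp)]
  obtain ⟨y, hy, hyx⟩ := hper.exists_mem_cell x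
  rw [← hyx]
  exact Measure.eqOn_of_ae_eq h1 hf.continuousOn continuousOn_const hcl
    (cell_subset_closedCell hy)

/-- Energy estimate: a solution with bounded velocity gradient is the only one with its initial
datum. -/
theorem IsNSSolution.unique {ν T K : ℝ} (hν : 0 ≤ ν) {u₀ : E3 → E3} {u w : ℝ → E3 → E3}
    (hu : IsNSSolution ν T u₀ u) (hK : ∀ t ∈ Ioo 0 T, ∀ x, ‖fderiv ℝ (u t) x‖ ≤ K)
    (hw : IsNSSolution ν T u₀ w) : ∀ t ∈ Icc 0 T, w t = u t := by
  obtain ⟨Pu, hPu, hPup, hPue⟩ := hu.momentum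
  obtain ⟨Pw, hPw, hPwp, hPwe⟩ := hw.momentum
  set en : ℝ → ℝ := fun t => ∫ x in cell, ‖w t x - u t x‖ ^ 2 with hen
  have hcont : ContinuousOn en (Icc 0 T) :=
    continuousOn_integral_cell (g := fun t x => ‖w t x - u t x‖ ^ 2)
      ((hw.cont.sub hu.cont).norm.pow 2)
  have hen0 : ∀ t, 0 ≤ en t := fun t => integral_nonneg fun x => by positivity
  have hder : ∀ t ∈ Ioo 0 T, HasDerivAt en (deriv en t) t ∧ deriv en t ≤ 2 * K * en t := by
    intro t ht
    have htc : t ∈ Ioc 0 T := Ioo_subset_Ioc_self ht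
    obtain ⟨hI, hD⟩ :
        IntegrableOn (fun x => deriv (fun τ => ‖w τ x - u τ x‖ ^ 2) t) cell ∧
        HasDerivAt en (∫ x in cell, deriv (fun τ => ‖w τ x - u τ x‖ ^ 2) t) t :=
      hasDerivAt_integral_cell (g := fun t x => ‖w t x - u t x‖ ^ 2) ht
        ((((hw.smooth.sub hu.smooth).norm_sq ℝ).of_le (by norm_cast)).mono
          (prod_mono_left Ioo_subset_Ioc_self))
    have hdw := hw.contDiff_slice htc
    have hdu := hu.contDiff_slice htc
    have hpP : ContDiff ℝ ∞ (fun x => Pw t x - Pu t x) :=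
      (contDiffOn_univ.1 (hPw.comp (f := fun x => (t, x)) (by fun_prop)
        fun x _ => ⟨htc, mem_univ x⟩)).sub
      (contDiffOn_univ.1 (hPu.comp (f := fun x => (t, x)) (by fun_prop)
        fun x _ => ⟨htc, mem_univ x⟩))
    set D : E3 → E3 := fun x => w t x - u t x with hDdef
    set p : E3 → ℝ := fun x => Pw t x - Pu t x with hpdef
    have hDs : ContDiff ℝ ∞ D := hdw.sub hdu
    have hDper : IsPeriodic D := fun x i => by
      simp only [hDdef]
      rw [hw.periodic t (Ioc_subset_Icc_self htc) x i, hu.periodic t (Ioc_subset_Icc_self htc) x i]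
    have hfD : ∀ x, fderiv ℝ D x = fderiv ℝ (w t) x - fderiv ℝ (u t) x := fun x =>
      fderiv_sub (hdw.differentiable (by simp) x) (hdu.differentiable (by simp) x)
    have hdivD : ∀ x, divergence D x = 0 := fun x => by
      have h1 := hw.divFree t htc x
      have h2 := hu.divFree t htc x
      simp only [divergence] at h1 h2 ⊢
      simp [hfD, Finset.sum_sub_distrib, h1, h2]
    have hderiv : ∀ x, deriv (fun τ => ‖w τ x - u τ x‖ ^ 2) t
        ≤ 2 * ∑ i, fderiv ℝ (fun y => ν * inner ℝ (D y) (fderiv ℝ D y (e i))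
          - w t y i * (1 / 2 * ‖D y‖ ^ 2) - p y * D y i) x (e i) + 2 * K * ‖D x‖ ^ 2 := by
      intro x
      rw [((hw.hasDerivAt ht x).fun_sub (hu.hasDerivAt ht x)).norm_sq.deriv,
        sum_fderiv_energyFlux ν (hdw.of_le (by norm_cast)) (hDs.of_le (by norm_cast))
          (hpP.of_le (by norm_cast)) (hw.divFree t htc) hdivD x]
      have hew := hPwe t htc x
      have heu := hPue t htc x
      have hlap : Laplacian.laplacian D x
          = Laplacian.laplacian (w t) x - Laplacian.laplacian (u t) x :=
        (hdw.of_le (by norm_cast)).contDiffAt.laplacian_sub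
          (hdu.of_le (by norm_cast)).contDiffAt
      have hgr : gradient p x = gradient (Pw t) x - gradient (Pu t) x := by
        have h1 : DifferentiableAt ℝ (Pw t) x :=
          ((contDiffOn_univ.1 (hPw.comp (f := fun x => (t, x)) (by fun_prop)
            fun x _ => ⟨htc, mem_univ x⟩)).differentiable (by simp)) x
        have h2 : DifferentiableAt ℝ (Pu t) x :=
          ((contDiffOn_univ.1 (hPu.comp (f := fun x => (t, x)) (by fun_prop)
            fun x _ => ⟨htc, mem_univ x⟩)).differentiable (by simp)) x
        simp only [gradient, hpdef]
        rw [fderiv_fun_sub h1 h2, map_sub]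
      have hmain : derivWithin (fun τ => w τ x) (Ioc 0 T) t
          - derivWithin (fun τ => u τ x) (Ioc 0 T) t
          = ν • Laplacian.laplacian D x - fderiv ℝ D x (w t x) - fderiv ℝ (u t) x (D x)
            - gradient p x := by
        rw [hlap, hgr, hfD, smul_sub, ← hew, ← heu]
        simp only [hDdef, map_sub, sub_apply]
        abel
      rw [hmain]
      -- the only term of the energy balance that is neither a flux nor dissipative
      have hbd : -inner ℝ (D x) (fderiv ℝ (u t) x (D x)) ≤ K * ‖D x‖ ^ 2 := by
        have h1 := abs_real_inner_le_norm (D x) (fderiv ℝ (u t) x (D x))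
        have h2 := (fderiv ℝ (u t) x).le_of_opNorm_le (hK t ht x) (D x)
        have h3 := mul_le_mul_of_nonneg_left h2 (norm_nonneg (D x))
        have h4 := neg_le_abs (inner ℝ (D x) (fderiv ℝ (u t) x (D x)))
        nlinarith
      have hpos : 0 ≤ ν * ∑ i, ‖fderiv ℝ D x (e i)‖ ^ 2 := by positivity
      have hDx : w t x - u t x = D x := rfl
      simp only [hDx, inner_sub_right, inner_smul_right]
      linarith
    have hcoe : ∀ i : Fin 3, ContDiff ℝ ∞ fun y : E3 => y i := fun i =>
      (EuclideanSpace.proj i : E3 →L[ℝ] ℝ).contDiff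
    have hflux : ∀ i, ContDiff ℝ 1 (fun y => ν * inner ℝ (D y) (fderiv ℝ D y (e i))
          - w t y i * (1 / 2 * ‖D y‖ ^ 2) - p y * D y i) := by
      intro i
      have h0 : ContDiff ℝ ∞ fun y => fderiv ℝ D y (e i) :=
        (hDs.fderiv_right (m := ∞) (by norm_cast)).clm_apply contDiff_const
      have h1 : ContDiff ℝ ∞ fun y => w t y i := (hcoe i).comp hdw
      have h2 : ContDiff ℝ ∞ fun y => D y i := (hcoe i).comp hDs
      have h3 : ContDiff ℝ ∞ fun y => inner ℝ (D y) (fderiv ℝ D y (e i)) := hDs.inner ℝ h0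
      exact (((contDiff_const.mul h3).sub (h1.mul (contDiff_const.mul (hDs.norm_sq ℝ)))).sub
        (hpP.mul h2)).of_le (by norm_cast)
    have hfluxper : ∀ i, IsPeriodic (fun y => ν * inner ℝ (D y) (fderiv ℝ D y (e i))
          - w t y i * (1 / 2 * ‖D y‖ ^ 2) - p y * D y i) := by
      intro i x j
      have h1 := hw.periodic t (Ioc_subset_Icc_self htc) x j
      have h2 : p (x + (2 * Real.pi) • e j) = p x := by
        simp only [hpdef]
        rw [hPwp t htc x j, hPup t htc x j]
      simp only [hDper x j, hDper.fderiv x j, h1, h2]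
    have hzero := integral_cell_sum_fderiv_eq_zero _ hflux hfluxper
    refine ⟨hD.differentiableAt.hasDerivAt, ?_⟩
    rw [hD.deriv]
    have hI1 : IntegrableOn (fun x => ∑ i, fderiv ℝ (fun y =>
        ν * inner ℝ (D y) (fderiv ℝ D y (e i))
          - w t y i * (1 / 2 * ‖D y‖ ^ 2) - p y * D y i) x (e i)) cell :=
      integrableOn_cell (continuous_finsetSum _ fun i _ =>
        ((hflux i).continuous_fderiv one_ne_zero).clm_apply continuous_const)
    have hI2 : IntegrableOn (fun x => ‖D x‖ ^ 2) cell :=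
      integrableOn_cell (hDs.continuous.norm.pow 2)
    have hI3 : ∫ x in cell, (2 * ∑ i, fderiv ℝ (fun y =>
        ν * inner ℝ (D y) (fderiv ℝ D y (e i))
          - w t y i * (1 / 2 * ‖D y‖ ^ 2) - p y * D y i) x (e i) + 2 * K * ‖D x‖ ^ 2)
        = 2 * K * en t := by
      rw [integral_add (hI1.const_mul 2) (hI2.const_mul (2 * K)), integral_const_mul,
        integral_const_mul, hzero]
      simp [hen, hDdef]
    rw [← hI3]
    exact integral_mono hI ((hI1.const_mul 2).add (hI2.const_mul (2 * K))) hderiv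
  -- Gronwall's inequality
  have hanti : AntitoneOn (fun t => Real.exp (-(2 * K) * t) * en t) (Icc 0 T) := by
    have hexp : ∀ t : ℝ, HasDerivAt (fun t : ℝ => Real.exp (-(2 * K) * t))
        (Real.exp (-(2 * K) * t) * (-(2 * K))) t := fun t => by
      simpa using ((hasDerivAt_id t).const_mul (-(2 * K))).exp
    have hd : ∀ t ∈ interior (Icc 0 T), HasDerivAt (fun t => Real.exp (-(2 * K) * t) * en t)
        (Real.exp (-(2 * K) * t) * (-(2 * K)) * en t + Real.exp (-(2 * K) * t) * deriv en t) t :=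
      fun t ht => (hexp t).mul (hder t (by rwa [interior_Icc] at ht)).1
    refine antitoneOn_of_deriv_nonpos (convex_Icc 0 T) (ContinuousOn.mul (by fun_prop) hcont)
      (fun t ht => (hd t ht).differentiableAt.differentiableWithinAt) fun t ht => ?_
    rw [(hd t ht).deriv]
    have h1 := (hder t (by rwa [interior_Icc] at ht)).2
    have h2 := mul_le_mul_of_nonneg_left h1 (Real.exp_pos (-(2 * K) * t)).le
    linarith
  intro t ht
  have hT : 0 ≤ T := ht.1.trans ht.2
  have h0 : en 0 = 0 := by simp [hen, hw.initial, hu.initial]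
  have h1 := hanti ⟨le_rfl, hT⟩ ht ht.1
  simp only [h0, mul_zero] at h1
  have h2 : en t = 0 :=
    le_antisymm (nonpos_of_mul_nonpos_right h1 (Real.exp_pos _)) (hen0 t)
  have hc : ∀ {v : ℝ → E3 → E3}, IsNSSolution ν T u₀ v → Continuous (v t) := fun hv =>
    continuousOn_univ.1 (hv.cont.comp (f := fun x => (t, x)) (by fun_prop)
      fun x _ => ⟨ht, mem_univ x⟩)
  funext x
  have h3 := eq_zero_of_integral_cell_eq_zero (f := fun x => ‖w t x - u t x‖ ^ 2)
    (((hc hw).sub (hc hu)).norm.pow 2) (fun x => by positivity)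
    (fun x i => by simp only [hw.periodic t ht x i, hu.periodic t ht x i]) h2 x
  exact sub_eq_zero.1 (norm_eq_zero.1 (pow_eq_zero_iff two_ne_zero |>.1 h3))

/-! ### The heat semigroup on plane waves -/

lemma heatKernel_nonneg {s : ℝ} (hs : 0 < s) (y : E3) : 0 ≤ heatKernel s y := by
  unfold heatKernel; positivity

lemma cexp_eq_ofReal_heatExp (s : ℝ) (k y : E3) :
    Complex.exp (-((1 / (4 * s) : ℝ) : ℂ) * ‖y‖ ^ 2 + Complex.I * (inner ℝ k y : ℝ))
      = (Real.exp (-‖y‖ ^ 2 / (4 * s)) : ℂ) * Complex.exp ((inner ℝ k y : ℝ) * Complex.I) := by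
  rw [Complex.ofReal_exp, ← Complex.exp_add]
  congr 1
  push_cast
  ring

lemma integrable_heatKernel {s : ℝ} (hs : 0 < s) : Integrable (heatKernel s) := by
  have h := GaussianFourier.integrable_cexp_neg_mul_sq_norm_add (V := E3)
    (b := ((1 / (4 * s) : ℝ) : ℂ)) (by rw [Complex.ofReal_re]; positivity) Complex.I 0
  have h2 := h.re
  refine (h2.const_mul ((4 * Real.pi * s) ^ (-(3 / 2) : ℝ))).congr (ae_of_all _ fun y => ?_)
  beta_reduce
  rw [cexp_eq_ofReal_heatExp, inner_zero_left, Complex.ofReal_zero, zero_mul, Complex.exp_zero,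
    mul_one]
  rfl

lemma integral_heatKernel_mul_cexp {s : ℝ} (hs : 0 < s) (k : E3) :
    ∫ y, (heatKernel s y : ℂ) * Complex.exp ((inner ℝ k y : ℝ) * Complex.I)
      = (Real.exp (-s * ‖k‖ ^ 2) : ℂ) := by
  have h := GaussianFourier.integral_cexp_neg_mul_sq_norm_add (V := E3)
    (b := ((1 / (4 * s) : ℝ) : ℂ)) (by rw [Complex.ofReal_re]; positivity) Complex.I k
  simp only [cexp_eq_ofReal_heatExp] at h
  have h4 : (0 : ℝ) < 4 * Real.pi * s := by positivity
  simp only [heatKernel, Complex.ofReal_mul, mul_assoc]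
  rw [integral_const_mul, h]
  have hb : (Real.pi : ℂ) / ((1 / (4 * s) : ℝ) : ℂ) = ((4 * Real.pi * s : ℝ) : ℂ) := by
    push_cast; field_simp
  rw [hb]
  have hdim : ((Module.finrank ℝ E3 : ℂ) / 2) = ((3 / 2 : ℝ) : ℂ) := by simp
  rw [hdim, ← Complex.ofReal_cpow h4.le, ← mul_assoc, ← Complex.ofReal_mul,
    show 4 * (Real.pi * s) = 4 * Real.pi * s by ring, ← Real.rpow_add h4]
  simp only [neg_add_cancel, Real.rpow_zero, Complex.ofReal_one, one_mul]
  rw [Complex.ofReal_exp]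
  congr 1
  push_cast
  rw [Complex.I_sq]
  have : (s : ℂ) ≠ 0 := by exact_mod_cast hs.ne'
  field_simp

lemma integrable_heatKernel_mul {s : ℝ} (hs : 0 < s) {f : E3 → ℝ} (hf : Continuous f) {C : ℝ}
    (hC : ∀ x, |f x| ≤ C) : Integrable fun y => heatKernel s y * f y :=
  (integrable_heatKernel hs).mul_bdd hf.aestronglyMeasurable (ae_of_all _ hC)

lemma integral_heatKernel_mul_cos {s : ℝ} (hs : 0 < s) (k : E3) :
    ∫ y, heatKernel s y * Real.cos (inner ℝ k y) = Real.exp (-s * ‖k‖ ^ 2) := by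
  have h := congrArg Complex.re (integral_heatKernel_mul_cexp hs k)
  rw [Complex.ofReal_re, ← RCLike.re_eq_complex_re, ← integral_re] at h
  · rw [← h]
    refine integral_congr_ae (ae_of_all _ fun y => ?_)
    simp [Complex.exp_ofReal_mul_I_re]
  · refine (integrable_heatKernel hs).ofReal.mul_bdd (c := 1) ?_ (ae_of_all _ fun y => ?_)
    · exact Continuous.aestronglyMeasurable (by fun_prop)
    · rw [Complex.norm_exp_ofReal_mul_I]

lemma integral_heatKernel_mul_sin (s : ℝ) (k : E3) :
    ∫ y, heatKernel s y * Real.sin (inner ℝ k y) = 0 := by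
  have h := integral_neg_eq_self (fun y => heatKernel s y * Real.sin (inner ℝ k y)) volume
  simp only [inner_neg_right, Real.sin_neg, mul_neg, heatKernel, norm_neg, integral_neg] at h
  simp only [heatKernel]
  linarith

lemma integral_heatKernel {s : ℝ} (hs : 0 < s) : ∫ y, heatKernel s y = 1 := by
  simpa using integral_heatKernel_mul_cos hs 0

/-- Plane waves are eigenfunctions of the heat semigroup. -/
lemma heat_sin {s : ℝ} (hs : 0 < s) (k x : E3) :
    heat s (fun x => Real.sin (inner ℝ k x)) x
      = Real.exp (-s * ‖k‖ ^ 2) * Real.sin (inner ℝ k x) := by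
  have hc := integrable_heatKernel_mul hs (f := fun y => Real.cos (inner ℝ k y)) (by fun_prop)
    fun y => Real.abs_cos_le_one _
  have hsn := integrable_heatKernel_mul hs (f := fun y => Real.sin (inner ℝ k y)) (by fun_prop)
    fun y => Real.abs_sin_le_one _
  have : ∀ y, heatKernel s y • Real.sin (inner ℝ k (x - y))
      = Real.sin (inner ℝ k x) * (heatKernel s y * Real.cos (inner ℝ k y))
        - Real.cos (inner ℝ k x) * (heatKernel s y * Real.sin (inner ℝ k y)) := fun y => by
    rw [inner_sub_right, Real.sin_sub, smul_eq_mul]; ring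
  simp only [heat, this]
  rw [integral_sub (hc.const_mul _) (hsn.const_mul _), integral_const_mul, integral_const_mul,
    integral_heatKernel_mul_cos hs, integral_heatKernel_mul_sin]
  ring

lemma heat_smul_const {F : Type*} [NormedAddCommGroup F] [NormedSpace ℝ F] [CompleteSpace F]
    (s : ℝ) (f : E3 → ℝ) (a : F) (x : E3) : heat s (fun x => f x • a) x = heat s f x • a := by
  simp only [heat, ← smul_assoc]
  exact integral_smul_const _ _

lemma abs_heat_le {s : ℝ} (hs : 0 < s) {f : E3 → ℝ} {C : ℝ}
    (hC : ∀ x, |f x| ≤ C) (x : E3) : |heat s f x| ≤ C := by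
  have h := norm_integral_le_of_norm_le ((integrable_heatKernel hs).mul_const C)
    (f := fun y => heatKernel s y • f (x - y)) (ae_of_all _ fun y => by
      rw [norm_smul, Real.norm_of_nonneg (heatKernel_nonneg hs y)]
      exact mul_le_mul_of_nonneg_left (hC _) (heatKernel_nonneg hs y))
  rwa [integral_mul_const, integral_heatKernel hs, one_mul] at h

/-! ### Bounds on the Besov norm -/

/-- The Besov norm of a field of constant direction depends only on the length of the direction. -/
lemma besovNorm_smul_const_congr {F G : Type*} [NormedAddCommGroup F] [NormedSpace ℝ F]
    [CompleteSpace F] [NormedAddCommGroup G] [NormedSpace ℝ G] [CompleteSpace G]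
    (f : E3 → ℝ) {a : F} {b : G} (hab : ‖a‖ = ‖b‖) :
    besovNorm (fun x => f x • a) = besovNorm (fun x => f x • b) := by
  simp only [besovNorm]
  congr! 4 with s
  refine eLpNorm_congr_norm_ae (ae_of_all _ fun x => ?_)
  rw [heat_smul_const, heat_smul_const, norm_smul, norm_smul, hab]

lemma besovNorm_sin_smul_le {F : Type*} [NormedAddCommGroup F] [NormedSpace ℝ F]
    [CompleteSpace F] {k : E3} (hk : k ≠ 0) (a : F) :
    besovNorm (fun x => Real.sin (inner ℝ k x) • a) ≤ ENNReal.ofReal (‖a‖ / ‖k‖) := by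
  refine iSup₂_le fun s hs => ?_
  have hk' : 0 < ‖k‖ := norm_pos_iff.2 hk
  have h1 : eLpNorm (heat s fun x => Real.sin (inner ℝ k x) • a) ∞ volume
      ≤ ENNReal.ofReal (Real.exp (-s * ‖k‖ ^ 2) * ‖a‖) := by
    rw [eLpNorm_exponent_top]
    refine eLpNormEssSup_le_of_ae_bound (ae_of_all _ fun x => ?_)
    rw [heat_smul_const, heat_sin hs, norm_smul, norm_mul, Real.norm_of_nonneg (Real.exp_pos _).le]
    refine mul_le_mul_of_nonneg_right ?_ (norm_nonneg a)
    exact mul_le_of_le_one_right (Real.exp_pos _).le (Real.abs_sin_le_one _)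
  refine (mul_le_mul_right h1 _).trans ?_
  rw [← ENNReal.ofReal_mul (Real.sqrt_nonneg s)]
  refine ENNReal.ofReal_le_ofReal ?_
  -- `r e^{-r²} ≤ 1` with `r = √s ‖k‖`
  have h2 : Real.sqrt s * ‖k‖ * Real.exp (-s * ‖k‖ ^ 2) ≤ 1 := by
    have h3 : Real.sqrt s * ‖k‖ ≤ Real.exp (s * ‖k‖ ^ 2) := by
      have h4 := Real.add_one_le_exp (s * ‖k‖ ^ 2)
      have h5 : (Real.sqrt s * ‖k‖) ^ 2 = s * ‖k‖ ^ 2 := by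
        rw [mul_pow, Real.sq_sqrt hs.le]
      nlinarith [sq_nonneg (Real.sqrt s * ‖k‖ - 1)]
    have h4 := mul_le_mul_of_nonneg_right h3 (Real.exp_pos (-s * ‖k‖ ^ 2)).le
    rwa [← Real.exp_add, show s * ‖k‖ ^ 2 + -s * ‖k‖ ^ 2 = 0 by ring, Real.exp_zero] at h4
  rw [le_div_iff₀ hk']
  nlinarith [mul_le_mul_of_nonneg_right h2 (norm_nonneg a)]

lemma ofReal_le_eLpNorm_top {f : E3 → ℝ} {U : Set E3} (hU : IsOpen U) (hne : U.Nonempty) {c : ℝ}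
    (h : ∀ x ∈ U, c ≤ f x) : ENNReal.ofReal c ≤ eLpNorm f ∞ volume := by
  by_contra! hlt
  have h1 : ∀ᵐ x, ‖f x‖ₑ < ENNReal.ofReal c :=
    ae_lt_of_essSup_lt (by rwa [eLpNorm_exponent_top] at hlt)
  have h2 : ∀ᵐ x, x ∉ U := by
    filter_upwards [h1] with x hx hxU
    refine absurd hx (not_lt.2 ?_)
    rw [← ofReal_norm]
    exact ENNReal.ofReal_le_ofReal ((h x hxU).trans (le_abs_self _))
  exact (hU.measure_pos volume hne).ne' (by simpa [ae_iff] using h2)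

/-- A function within `ε` of the plane wave `m sin ⟪h, x⟫` has Besov norm of order `m`. -/
lemma ofReal_le_besovNorm {f : E3 → ℝ} (hf : Continuous f) {h : E3} (hh : h ≠ 0) {m ε : ℝ}
    (hm : 0 ≤ m) (hε : ∀ x, |f x - m * Real.sin (inner ℝ h x)| ≤ ε) {s : ℝ} (hs : 0 < s) :
    ENNReal.ofReal (Real.sqrt s * (m * Real.exp (-s * ‖h‖ ^ 2) / 2 - ε)) ≤ besovNorm f := by
  have hsplit : ∀ x, heat s f x = m * (Real.exp (-s * ‖h‖ ^ 2) * Real.sin (inner ℝ h x))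
      + heat s (fun x => f x - m * Real.sin (inner ℝ h x)) x := by
    intro x
    rw [← heat_sin hs]
    simp only [heat, smul_eq_mul]
    rw [← integral_const_mul, ← integral_add]
    · exact integral_congr_ae (ae_of_all _ fun y => by simp only; ring)
    · exact (integrable_heatKernel_mul hs (f := fun y => Real.sin (inner ℝ h (x - y)))
        (by fun_prop) fun y => Real.abs_sin_le_one _).const_mul m
    · exact integrable_heatKernel_mul hs
        (f := fun y => f (x - y) - m * Real.sin (inner ℝ h (x - y))) (by fun_prop) fun y => hε _
  rw [ENNReal.ofReal_mul (Real.sqrt_nonneg s)]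
  refine le_trans (mul_le_mul_right ?_ _) (le_iSup₂ (f := fun (s : ℝ) (_ : 0 < s) =>
    ENNReal.ofReal (Real.sqrt s) * eLpNorm (heat s f) ∞ volume) s hs)
  refine ofReal_le_eLpNorm_top (U := {x | 1 / 2 < Real.sin (inner ℝ h x)})
    (isOpen_lt continuous_const (by fun_prop)) ⟨(Real.pi / 2 / ‖h‖ ^ 2) • h, ?_⟩ fun x hx => ?_
  · have : ‖h‖ ≠ 0 := norm_ne_zero_iff.2 hh
    simp only [mem_ofPred_eq, inner_smul_right, real_inner_self_eq_norm_sq]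
    rw [div_mul_cancel₀ _ (pow_ne_zero 2 this), Real.sin_pi_div_two]
    norm_num
  · rw [hsplit]
    have h1 := abs_le.1 (abs_heat_le hs hε x)
    have h2 : m * Real.exp (-s * ‖h‖ ^ 2) * (1 / 2)
        ≤ m * Real.exp (-s * ‖h‖ ^ 2) * Real.sin (inner ℝ h x) :=
      mul_le_mul_of_nonneg_left (le_of_lt hx) (by positivity)
    linarith [h1.1]

/-! ### Lower bounds on the `L³` norm -/

lemma ofReal_mul_le_L3Norm {f : E3 → ℝ} {S : Set E3} (hS : MeasurableSet S) (hSc : S ⊆ cell) {c : ℝ}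
    (hc : ∀ x ∈ S, c ≤ |f x|) :
    ENNReal.ofReal c * volume S ^ (1 / 3 : ℝ) ≤ L3Norm f := by
  rcases le_or_gt c 0 with h0 | h0
  · simp [ENNReal.ofReal_of_nonpos h0]
  have h1 : eLpNorm (S.indicator fun _ => c) 3 (volume.restrict cell)
      ≤ eLpNorm f 3 (volume.restrict cell) := by
    refine eLpNorm_mono fun x => ?_
    by_cases hx : x ∈ S
    · simpa [hx, abs_of_pos h0] using hc x hx
    · simp [hx]
  rw [eLpNorm_indicator_const hS (by norm_num) (by norm_num), Measure.restrict_apply hS,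
    inter_eq_self_of_subset_left hSc, Real.enorm_of_nonneg h0.le] at h1
  simpa [L3Norm] using h1

/-- A coordinate box. -/
def box (a b : Fin 3 → ℝ) : Set E3 := {x | ∀ i, x i ∈ Icc (a i) (b i)}

lemma box_eq_preimage (a b : Fin 3 → ℝ) :
    box a b = (WithLp.ofLp : E3 → Fin 3 → ℝ) ⁻¹' (Icc a b) := by
  ext x; simp [box, ← pi_univ_Icc]

lemma measurableSet_box (a b : Fin 3 → ℝ) : MeasurableSet (box a b) := by
  rw [box_eq_preimage]
  exact measurableSet_Icc.preimage (PiLp.volume_preserving_ofLp (Fin 3)).measurable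

lemma volume_box (a b : Fin 3 → ℝ) : volume (box a b) = ∏ i, ENNReal.ofReal (b i - a i) := by
  rw [box_eq_preimage, (PiLp.volume_preserving_ofLp (Fin 3)).measure_preimage
    measurableSet_Icc.nullMeasurableSet, Real.volume_Icc_pi]

/-! ### An infinite linear system on the lattice -/

/-- The `ℓ¹` size `|i| + |j|` of a lattice index. -/
def ord (k : ℤ × ℤ) : ℝ := |(k.1 : ℝ)| + |(k.2 : ℝ)|

lemma ord_nonneg (k : ℤ × ℤ) : 0 ≤ ord k := by unfold ord; positivity

/-- The action of transport by two crossing sine shears of strengths `a` and `b` on the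
coefficients of a sine series in two phases. -/
def adv (a b : ℝ) (x : ℤ × ℤ → ℝ) (k : ℤ × ℤ) : ℝ :=
  -a * k.2 * (x (k.1 - 1, k.2) - x (k.1 + 1, k.2)) + b * k.1 * (x (k.1, k.2 - 1) - x (k.1, k.2 + 1))

lemma adv_sub (a b : ℝ) (x y : ℤ × ℤ → ℝ) (k : ℤ × ℤ) :
    adv a b (fun k => x k - y k) k = adv a b x k - adv a b y k := by
  simp only [adv]; ring

lemma abs_adv_le {a b : ℝ} (hb : 0 ≤ b) (hba : b ≤ a) {x : ℤ × ℤ → ℝ} {M r : ℝ} (hr : 0 ≤ r)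
    (hM : 0 ≤ M) (hx : ∀ k, |x k| ≤ M * Real.exp (-r * ord k)) (k : ℤ × ℤ) :
    |adv a b x k| ≤ 2 * a * ord k * (M * Real.exp r * Real.exp (-r * ord k)) := by
  set B := M * Real.exp r * Real.exp (-r * ord k) with hB
  have hn : ∀ k', ord k - 1 ≤ ord k' → |x k'| ≤ B := by
    intro k' h
    refine (hx k').trans ?_
    rw [hB, mul_assoc, ← Real.exp_add]
    refine mul_le_mul_of_nonneg_left (Real.exp_le_exp.2 ?_) hM
    nlinarith
  have tri : ∀ z : ℤ, |(z : ℝ)| - 1 ≤ |((z - 1 : ℤ) : ℝ)| ∧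
      |(z : ℝ)| - 1 ≤ |((z + 1 : ℤ) : ℝ)| := by
    intro z
    push_cast
    have h1 := abs_sub_abs_le_abs_sub (z : ℝ) 1
    have h2 := abs_sub_abs_le_abs_sub (z : ℝ) (-1)
    rw [abs_one] at h1
    rw [abs_neg, abs_one, sub_neg_eq_add] at h2
    exact ⟨h1, h2⟩
  have h1 : |x (k.1 - 1, k.2) - x (k.1 + 1, k.2)| ≤ 2 * B := by
    have e1 := hn (k.1 - 1, k.2) (by have := (tri k.1).1; simp only [ord]; linarith)
    have e2 := hn (k.1 + 1, k.2) (by have := (tri k.1).2; simp only [ord]; linarith)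
    linarith [abs_sub (x (k.1 - 1, k.2)) (x (k.1 + 1, k.2))]
  have h2 : |x (k.1, k.2 - 1) - x (k.1, k.2 + 1)| ≤ 2 * B := by
    have e1 := hn (k.1, k.2 - 1) (by have := (tri k.2).1; simp only [ord]; linarith)
    have e2 := hn (k.1, k.2 + 1) (by have := (tri k.2).2; simp only [ord]; linarith)
    linarith [abs_sub (x (k.1, k.2 - 1)) (x (k.1, k.2 + 1))]
  have hB0 : 0 ≤ B := by positivity
  have ha : 0 ≤ a := hb.trans hba
  calc |adv a b x k| ≤ |-a * k.2 * (x (k.1 - 1, k.2) - x (k.1 + 1, k.2))|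
        + |b * k.1 * (x (k.1, k.2 - 1) - x (k.1, k.2 + 1))| := abs_add_le _ _
    _ = a * |(k.2 : ℝ)| * |x (k.1 - 1, k.2) - x (k.1 + 1, k.2)|
        + b * |(k.1 : ℝ)| * |x (k.1, k.2 - 1) - x (k.1, k.2 + 1)| := by
      rw [abs_mul, abs_mul, abs_mul, abs_mul, abs_neg, abs_of_nonneg ha, abs_of_nonneg hb]
    _ ≤ a * |(k.2 : ℝ)| * (2 * B) + a * |(k.1 : ℝ)| * (2 * B) := by gcongr
    _ = 2 * a * ord k * B := by simp only [ord]; ring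

/-- Truncation of time to `[0, T]`. -/
def clip (T t : ℝ) : ℝ := max 0 (min t T)

lemma clip_of_mem {T t : ℝ} (ht : t ∈ Icc 0 T) : clip T t = t := by
  simp [clip, ht.1, ht.2]

lemma clip_mem {T : ℝ} (hT : 0 ≤ T) (t : ℝ) : clip T t ∈ Icc 0 T :=
  ⟨le_max_left _ _, max_le hT (min_le_right _ _)⟩

lemma continuous_clip (T : ℝ) : Continuous (clip T) := by unfold clip; fun_prop

/-- The weight `exp (-(2 - t / T) (|i| + |j|))`: the radius of analyticity `2 - t / T` shrinks in
time, which pays for the derivative lost by transport. -/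
def weight (T : ℝ) (k : ℤ × ℤ) (t : ℝ) : ℝ := Real.exp (-(2 - clip T t / T) * ord k)

lemma continuous_weight (T : ℝ) (k : ℤ × ℤ) : Continuous (weight T k) := by
  have := continuous_clip T
  unfold weight; fun_prop

lemma weight_pos (T : ℝ) (k : ℤ × ℤ) (t : ℝ) : 0 < weight T k t := Real.exp_pos _

lemma weight_le {T : ℝ} (hT : 0 < T) (k : ℤ × ℤ) (t : ℝ) : weight T k t ≤ Real.exp (-ord k) := by
  refine Real.exp_le_exp.2 ?_
  have h : clip T t / T ≤ 1 := (div_le_one hT).2 (clip_mem hT.le t).2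
  nlinarith [ord_nonneg k]

/-- The right-hand side of the mode `k`: transport and a source at the mode `(1, 1)`. -/
def forcing (a b : ℝ) (E S : ℝ → ℝ) (c : ℤ × ℤ → ℝ → ℝ) (k : ℤ × ℤ) (t : ℝ) : ℝ :=
  E t * adv a b (fun k => c k t) k + if k = (1, 1) then S t else 0

lemma continuous_forcing {a b : ℝ} {E S : ℝ → ℝ} (hE : Continuous E) (hS : Continuous S)
    {c : ℤ × ℤ → ℝ → ℝ} (hc : ∀ k, Continuous (c k)) (k : ℤ × ℤ) :
    Continuous (forcing a b E S c k) := by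
  have h0 : Continuous fun t => if k = (1, 1) then S t else 0 := by
    split_ifs <;> fun_prop
  have h1 : Continuous fun t => adv a b (fun k => c k t) k := by
    unfold adv
    fun_prop
  exact (hE.mul h1).add h0

/-- Duhamel's formula for the mode `k` with damping `l k`. -/
def duhamel (a b : ℝ) (E S : ℝ → ℝ) (l : ℤ × ℤ → ℝ) (c : ℤ × ℤ → ℝ → ℝ) (k : ℤ × ℤ) (t : ℝ) : ℝ :=
  Real.exp (-l k * t) * ∫ s in (0 : ℝ)..t, Real.exp (l k * s) * forcing a b E S c k s

lemma hasDerivAt_duhamel {a b : ℝ} {E S : ℝ → ℝ} (hE : Continuous E) (hS : Continuous S)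
    (l : ℤ × ℤ → ℝ) {c : ℤ × ℤ → ℝ → ℝ} (hc : ∀ k, Continuous (c k)) (k : ℤ × ℤ) (t : ℝ) :
    HasDerivAt (duhamel a b E S l c k)
      (-l k * duhamel a b E S l c k t + forcing a b E S c k t) t := by
  have hcont : Continuous fun s => Real.exp (l k * s) * forcing a b E S c k s :=
    Continuous.mul (by fun_prop) (continuous_forcing hE hS hc k)
  have h1 := intervalIntegral.integral_hasDerivAt_right (hcont.intervalIntegrable 0 t)
    (hcont.stronglyMeasurableAtFilter _ _) hcont.continuousAt
  have h2 : HasDerivAt (fun t : ℝ => Real.exp (-l k * t)) (Real.exp (-l k * t) * (-l k)) t := by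
    simpa using ((hasDerivAt_id t).const_mul (-l k)).exp
  have h3 : Real.exp (-l k * t) * (Real.exp (l k * t) * forcing a b E S c k t)
      = forcing a b E S c k t := by
    rw [← mul_assoc, ← Real.exp_add]; simp
  convert! h2.mul h1 using 1
  rw [h3, duhamel]
  ring

/-- Contraction estimate in the weighted space, with factor `2 a exp 2 T`. -/
lemma abs_duhamel_sub_le {a b : ℝ} (hb : 0 ≤ b) (hba : b ≤ a) {E S : ℝ → ℝ} (hE : Continuous E)
    (hS : Continuous S) {T : ℝ} (hT : 0 < T) (hE1 : ∀ t ∈ Icc 0 T, |E t| ≤ 1)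
    {l : ℤ × ℤ → ℝ} (hl : ∀ k, 0 ≤ l k) {c d : ℤ × ℤ → ℝ → ℝ} (hc : ∀ k, Continuous (c k))
    (hd : ∀ k, Continuous (d k)) {M : ℝ} (hM : 0 ≤ M)
    (hcd : ∀ k t, |c k t - d k t| ≤ M * weight T k t) (k : ℤ × ℤ) {t : ℝ} (ht : t ∈ Icc 0 T) :
    |duhamel a b E S l c k t - duhamel a b E S l d k t|
      ≤ 2 * a * Real.exp 2 * T * M * weight T k t := by
  have hcont : ∀ {c : ℤ × ℤ → ℝ → ℝ}, (∀ k, Continuous (c k)) →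
      Continuous fun s => Real.exp (l k * s) * forcing a b E S c k s := fun hc =>
    Continuous.mul (by fun_prop) (continuous_forcing hE hS hc k)
  have ha : 0 ≤ a := hb.trans hba
  have hdiff : duhamel a b E S l c k t - duhamel a b E S l d k t = ∫ s in (0 : ℝ)..t,
      Real.exp (-l k * (t - s)) * (E s * adv a b (fun k => c k s - d k s) k) := by
    simp only [duhamel]
    rw [← mul_sub, ← intervalIntegral.integral_sub ((hcont hc).intervalIntegrable 0 t)
      ((hcont hd).intervalIntegrable 0 t), ← intervalIntegral.integral_const_mul]
    refine intervalIntegral.integral_congr fun s _ => ?_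
    simp only [forcing, adv_sub]
    rw [show -l k * (t - s) = -l k * t + l k * s by ring, Real.exp_add]
    ring
  have hbound : ∀ s ∈ Ioc 0 t,
      ‖Real.exp (-l k * (t - s)) * (E s * adv a b (fun k => c k s - d k s) k)‖
        ≤ 2 * a * Real.exp 2 * T * M * weight T k t
          * (ord k / T * Real.exp (-(ord k / T) * (t - s))) := by
    intro s hs
    have hsT : s ∈ Icc 0 T := ⟨hs.1.le, hs.2.trans ht.2⟩
    have hr : 0 ≤ 2 - s / T := by
      have : s / T ≤ 1 := (div_le_one hT).2 hsT.2
      linarith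
    have h1 := abs_adv_le hb hba hr hM (x := fun k => c k s - d k s)
      (fun k => by simpa [weight, clip_of_mem hsT] using hcd k s) k
    have h2 : Real.exp (-l k * (t - s)) ≤ 1 := by
      rw [Real.exp_le_one_iff]
      nlinarith [mul_nonneg (hl k) (sub_nonneg.2 hs.2)]
    have h3 : Real.exp (2 - s / T) ≤ Real.exp 2 := by
      refine Real.exp_le_exp.2 ?_
      have : 0 ≤ s / T := div_nonneg hs.1.le hT.le
      linarith
    have h4 : Real.exp (-(2 - s / T) * ord k)
        = weight T k t * Real.exp (-(ord k / T) * (t - s)) := by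
      rw [weight, clip_of_mem ht, ← Real.exp_add]
      congr 1
      field_simp
      ring
    rw [Real.norm_eq_abs, abs_mul, abs_mul, Real.abs_exp]
    calc Real.exp (-l k * (t - s)) * (|E s| * |adv a b (fun k => c k s - d k s) k|)
        ≤ 1 * (1 * (2 * a * ord k * (M * Real.exp 2 *
            (weight T k t * Real.exp (-(ord k / T) * (t - s)))))) := by
          have h5 : |adv a b (fun k => c k s - d k s) k| ≤ 2 * a * ord k * (M * Real.exp 2 *
            (weight T k t * Real.exp (-(ord k / T) * (t - s)))) := by
            rw [h4] at h1
            refine h1.trans ?_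
            have := ord_nonneg k
            have := (weight_pos T k t).le
            gcongr
          gcongr
          exact hE1 s hsT
      _ = _ := by field_simp
  -- the factor `ord k` lost by transport is regained by integrating the weight in time
  have hint : ∫ s in (0 : ℝ)..t, ord k / T * Real.exp (-(ord k / T) * (t - s)) ≤ 1 := by
    have h1 : ∀ s ∈ uIcc 0 t, HasDerivAt (fun s => Real.exp (-(ord k / T) * (t - s)))
        (ord k / T * Real.exp (-(ord k / T) * (t - s))) s := fun s _ => by
      convert! (((hasDerivAt_id s).const_sub t).const_mul (-(ord k / T))).exp using 1
      simp only [id]; ring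
    rw [intervalIntegral.integral_eq_sub_of_hasDerivAt h1
      (Continuous.intervalIntegrable (by fun_prop) _ _)]
    simp [(Real.exp_pos _).le]
  rw [hdiff, ← Real.norm_eq_abs]
  refine (intervalIntegral.norm_integral_le_of_norm_le ht.1
    (g := fun s => 2 * a * Real.exp 2 * T * M * weight T k t
          * (ord k / T * Real.exp (-(ord k / T) * (t - s))))
    (ae_of_all _ hbound) (Continuous.intervalIntegrable (by fun_prop) _ _)).trans ?_
  rw [intervalIntegral.integral_const_mul]
  have := (weight_pos T k t).le
  exact mul_le_of_le_one_right (by positivity) hint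

lemma abs_duhamel_zero_le {a b : ℝ} {E S : ℝ → ℝ} {T S₀ : ℝ} (hT : 0 < T)
    (hS1 : ∀ t ∈ Icc 0 T, |S t| ≤ S₀) {l : ℤ × ℤ → ℝ} (hl : ∀ k, 0 ≤ l k) (k : ℤ × ℤ) {t : ℝ}
    (ht : t ∈ Icc 0 T) :
    |duhamel a b E S l (fun _ _ => 0) k t| ≤ Real.exp 4 * S₀ * T * weight T k t := by
  have hS0 : 0 ≤ S₀ := (abs_nonneg _).trans (hS1 0 ⟨le_rfl, hT.le⟩)
  have hw := (weight_pos T k t).le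
  by_cases hk : k = (1, 1)
  · have hw4 : 1 ≤ Real.exp 4 * weight T k t := by
      rw [weight, clip_of_mem ht, ← Real.exp_add]
      refine Real.one_le_exp ?_
      have h : 0 ≤ t / T := div_nonneg ht.1 hT.le
      have : ord k = 2 := by rw [hk]; norm_num [ord]
      rw [this]; linarith
    have h1 : duhamel a b E S l (fun _ _ => 0) k t
        = ∫ s in (0 : ℝ)..t, Real.exp (-l k * (t - s)) * S s := by
      simp only [duhamel, forcing, adv, hk]
      rw [← intervalIntegral.integral_const_mul]
      refine intervalIntegral.integral_congr fun s _ => ?_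
      simp only [if_true]
      rw [show -l (1, 1) * (t - s) = -l (1, 1) * t + l (1, 1) * s by ring, Real.exp_add]
      ring
    have h2 := intervalIntegral.norm_integral_le_of_norm_le_const (a := (0 : ℝ)) (b := t) (C := S₀)
      (f := fun s => Real.exp (-l k * (t - s)) * S s) (fun s hs => by
        rw [uIoc_of_le ht.1] at hs
        rw [norm_mul, Real.norm_of_nonneg (Real.exp_pos _).le]
        have h3 : Real.exp (-l k * (t - s)) ≤ 1 := by
          rw [Real.exp_le_one_iff]
          nlinarith [mul_nonneg (hl k) (sub_nonneg.2 hs.2)]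
        exact (mul_le_of_le_one_left (norm_nonneg _) h3).trans
          (hS1 s ⟨hs.1.le, hs.2.trans ht.2⟩))
    rw [h1, ← Real.norm_eq_abs]
    refine h2.trans ?_
    rw [sub_zero, abs_of_nonneg ht.1]
    calc S₀ * t ≤ S₀ * T * 1 := by rw [mul_one]; exact mul_le_mul_of_nonneg_left ht.2 hS0
      _ ≤ S₀ * T * (Real.exp 4 * weight T k t) := by gcongr
      _ = _ := by ring
  · simp only [duhamel, forcing, adv, hk]
    simp
    positivity

/-- Solvability of the lattice system for times short compared with the transport rate, and
comparison of the solution with its first Duhamel iterate. -/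
theorem exists_coeff {a b : ℝ} (hb : 0 ≤ b) (hba : b ≤ a) {E S : ℝ → ℝ} (hE : Continuous E)
    (hS : Continuous S) {T S₀ : ℝ} (hT : 0 < T) (hE1 : ∀ t ∈ Icc 0 T, |E t| ≤ 1)
    (hS1 : ∀ t ∈ Icc 0 T, |S t| ≤ S₀) {l : ℤ × ℤ → ℝ} (hl : ∀ k, 0 ≤ l k)
    (hq : 2 * a * Real.exp 2 * T ≤ 1 / 2) :
    ∃ c : ℤ × ℤ → ℝ → ℝ, (∀ k, Continuous (c k)) ∧ (∀ k, c k 0 = 0) ∧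
      (∀ k t, |c k t| ≤ 2 * (Real.exp 4 * S₀ * T) * Real.exp (-ord k)) ∧
      (∀ k, ∀ t ∈ Ioo 0 T, HasDerivAt (c k) (-l k * c k t + forcing a b E S c k t) t) ∧
      (∀ k, ∀ t ∈ Icc 0 T, |c k t - duhamel a b E S l (fun _ _ => 0) k t|
        ≤ 2 * a * Real.exp 2 * T * (2 * (Real.exp 4 * S₀ * T)) * Real.exp (-ord k)) := by
  have hS0 : 0 ≤ S₀ := (abs_nonneg _).trans (hS1 0 ⟨le_rfl, hT.le⟩)
  have ha : 0 ≤ a := hb.trans hba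
  set q := 2 * a * Real.exp 2 * T with hqdef
  have hq0 : 0 ≤ q := by positivity
  set M := Real.exp 4 * S₀ * T with hMdef
  have hM : 0 ≤ M := by positivity
  -- The unknown is the weighted coefficient family `g`, in the Banach space of bounded continuous
  -- functions; `C g` restores the weight.
  let C : BoundedContinuousFunction ((ℤ × ℤ) × ℝ) ℝ → ℤ × ℤ → ℝ → ℝ :=
    fun g k t => weight T k t * g (k, t)
  have hC : ∀ g k, Continuous (C g k) := fun g k =>
    (continuous_weight T k).mul (g.continuous.comp (by fun_prop))
  have hCC : ∀ g g' : BoundedContinuousFunction ((ℤ × ℤ) × ℝ) ℝ, ∀ k t,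
      |C g k t - C g' k t| ≤ dist g g' * weight T k t := by
    intro g g' k t
    simp only [C]
    rw [← mul_sub, abs_mul, abs_of_pos (weight_pos T k t), mul_comm]
    rw [← Real.dist_eq]
    exact mul_le_mul_of_nonneg_right (BoundedContinuousFunction.dist_coe_le_dist (k, t))
      (weight_pos T k t).le
  have hC0 : C 0 = fun _ _ => 0 := by ext k t; simp [C]
  let φ : BoundedContinuousFunction ((ℤ × ℤ) × ℝ) ℝ →
      (ℤ × ℤ) × ℝ → ℝ := fun g p =>
    (weight T p.1 p.2)⁻¹ * duhamel a b E S l (C g) p.1 (clip T p.2)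
  have hφc : ∀ g, Continuous (φ g) := by
    intro g
    rw [continuous_prod_of_discrete_left]
    intro k
    have h1 : Continuous (duhamel a b E S l (C g) k) :=
      continuous_iff_continuousAt.2 fun t => (hasDerivAt_duhamel hE hS l (hC g) k t).continuousAt
    exact ((continuous_weight T k).inv₀ fun t => (weight_pos T k t).ne').mul
      (h1.comp (continuous_clip T))
  have hwc : ∀ k t, weight T k (clip T t) = weight T k t := fun k t => by
    simp only [weight, clip_of_mem (clip_mem hT.le t)]
  have hφd : ∀ g g' p, |φ g p - φ g' p| ≤ q * dist g g' := by
    intro g g' p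
    have h1 := abs_duhamel_sub_le hb hba hE hS hT hE1 hl (hC g) (hC g') dist_nonneg (hCC g g') p.1
      (clip_mem hT.le p.2)
    simp only [φ]
    rw [← mul_sub, abs_mul, abs_of_pos (inv_pos.2 (weight_pos T p.1 p.2)),
      inv_mul_le_iff₀ (weight_pos T p.1 p.2), mul_comm]
    rwa [hwc] at h1
  have hφ0 : ∀ p, |φ 0 p| ≤ M := by
    intro p
    have h1 := abs_duhamel_zero_le (a := a) (b := b) (E := E) hT hS1 hl p.1 (clip_mem hT.le p.2)
    simp only [φ]
    rw [abs_mul, abs_of_pos (inv_pos.2 (weight_pos T p.1 p.2)),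
      inv_mul_le_iff₀ (weight_pos T p.1 p.2), mul_comm, hC0]
    rwa [hwc] at h1
  have hφb : ∀ g p, ‖φ g p‖ ≤ q * dist g 0 + M := fun g p => by
    have h1 := hφd g 0 p
    have h2 := hφ0 p
    have h3 := abs_sub_abs_le_abs_sub (φ g p) (φ 0 p)
    rw [Real.norm_eq_abs]; linarith
  let Φ : BoundedContinuousFunction ((ℤ × ℤ) × ℝ) ℝ →
      BoundedContinuousFunction ((ℤ × ℤ) × ℝ) ℝ := fun g =>
    BoundedContinuousFunction.ofNormedAddCommGroup (φ g) (hφc g) _ (hφb g)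
  have hΦ : ContractingWith (1 / 2) Φ := by
    refine ⟨by norm_num [← NNReal.coe_lt_coe], LipschitzWith.of_dist_le_mul fun g g' => ?_⟩
    refine (BoundedContinuousFunction.dist_le (by positivity)).2 fun p => ?_
    rw [Real.dist_eq]
    refine (hφd g g' p).trans ?_
    have : ((1 / 2 : NNReal) : ℝ) = 1 / 2 := by norm_num
    rw [this]
    exact mul_le_mul_of_nonneg_right hq dist_nonneg
  obtain ⟨g, hg⟩ : ∃ g, Φ g = g := ⟨_, hΦ.fixedPoint_isFixedPt⟩
  have hgp : ∀ p, g p = φ g p := fun p => by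
    conv_lhs => rw [← hg]
    rfl
  have hgn : dist g 0 ≤ 2 * M := by
    have h1 : dist g 0 ≤ q * dist g 0 + M := by
      rw [dist_zero_right]
      refine (BoundedContinuousFunction.norm_le (by positivity)).2 fun p => ?_
      rw [hgp p, ← dist_zero_right g]
      exact hφb g p
    nlinarith [dist_nonneg (x := g) (y := 0)]
  have hfix : ∀ k t, C g k t = duhamel a b E S l (C g) k (clip T t) := by
    intro k t
    simp only [C]
    rw [hgp (k, t)]
    exact mul_inv_cancel_left₀ (weight_pos T k t).ne' _
  refine ⟨C g, hC g, fun k => ?_, fun k t => ?_, fun k t ht => ?_, fun k t ht => ?_⟩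
  · rw [hfix, clip_of_mem ⟨le_rfl, hT.le⟩, duhamel]
    simp
  · have h1 := hCC g 0 k t
    rw [hC0] at h1
    simp only [sub_zero] at h1
    refine h1.trans ?_
    exact mul_le_mul hgn (weight_le hT k t) (weight_pos T k t).le (by positivity)
  · have h1 := hasDerivAt_duhamel (a := a) (b := b) hE hS l (hC g) k t
    have h2 : duhamel a b E S l (C g) k t = C g k t := by
      rw [hfix, clip_of_mem (Ioo_subset_Icc_self ht)]
    rw [h2] at h1
    refine h1.congr_of_eventuallyEq ?_
    filter_upwards [Ioo_mem_nhds ht.1 ht.2] with s hs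
    rw [hfix, clip_of_mem (Ioo_subset_Icc_self hs)]
  · rw [hfix, clip_of_mem ht]
    have h1 := abs_duhamel_sub_le hb hba hE hS hT hE1 hl (hC g) (hC 0) dist_nonneg (hCC g 0) k ht
    rw [hC0] at h1
    refine h1.trans ?_
    have h2 := (weight_pos T k t).le
    exact mul_le_mul (mul_le_mul_of_nonneg_left hgn hq0) (weight_le hT k t) h2 (by positivity)

/-! ### Smoothness of sine series with decaying coefficients -/

lemma summable_exp_neg_mul_ord {r : ℝ} (hr : 0 < r) :
    Summable fun k : ℤ × ℤ => Real.exp (-r * ord k) := by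
  have h1 : Summable fun n : ℕ => Real.exp (-r * n) := by
    simpa [mul_comm] using Real.summable_exp_nat_mul_iff.2 (neg_lt_zero.2 hr)
  have h2 : Summable fun i : ℤ => Real.exp (-r * |(i : ℝ)|) :=
    summable_int_iff_summable_nat_and_neg.2 ⟨by simpa using h1, by simpa using h1⟩
  refine (h2.mul_of_nonneg h2 (fun _ => (Real.exp_pos _).le) fun _ => (Real.exp_pos _).le).congr
    fun k => ?_
  rw [← Real.exp_add, ord]
  ring_nf

/-- Coefficient families that decay exponentially, uniformly in time, also after multiplication by
any polynomial in the index. -/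
def RapidDecay (I : Set ℝ) (c : ℤ × ℤ → ℝ → ℝ) : Prop :=
  ∀ m : ℕ, ∃ C, ∀ k, ∀ t ∈ I, (1 + ord k) ^ m * |c k t| ≤ C * Real.exp (-(1 / 2) * ord k)

/-- Coefficient families whose first `n` time derivatives exist and decay rapidly. -/
def SmoothDecay (I : Set ℝ) : ℕ → (ℤ × ℤ → ℝ → ℝ) → Prop
  | 0, c => RapidDecay I c ∧ ∀ k, ContinuousOn (c k) I
  | n + 1, c => RapidDecay I c ∧
      ∃ c', SmoothDecay I n c' ∧ ∀ k, ∀ t ∈ I, HasDerivAt (c k) (c' k t) t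

section Decay

variable {I : Set ℝ} {c d : ℤ × ℤ → ℝ → ℝ} {n : ℕ}

lemma rapidDecay_of_exp {C : ℝ} (h : ∀ k, ∀ t ∈ I, |c k t| ≤ C * Real.exp (-ord k)) :
    RapidDecay I c := by
  intro m
  refine ⟨2 ^ m * m.factorial * Real.exp (1 / 2) * |C|, fun k t ht => ?_⟩
  have h0 := ord_nonneg k
  have h1 := Real.pow_div_factorial_le_exp ((1 + ord k) / 2) (by positivity) m
  rw [div_le_iff₀ (by positivity), div_pow, div_le_iff₀ (by positivity)] at h1
  have h2 : |c k t| ≤ |C| * Real.exp (-ord k) :=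
    (h k t ht).trans (mul_le_mul_of_nonneg_right (le_abs_self C) (Real.exp_pos _).le)
  calc (1 + ord k) ^ m * |c k t|
      ≤ (Real.exp ((1 + ord k) / 2) * m.factorial * 2 ^ m) * (|C| * Real.exp (-ord k)) := by
        gcongr
    _ = 2 ^ m * m.factorial * |C| * (Real.exp ((1 + ord k) / 2) * Real.exp (-ord k)) := by ring
    _ = 2 ^ m * m.factorial * |C| * (Real.exp (1 / 2) * Real.exp (-(1 / 2) * ord k)) := by
        rw [← Real.exp_add, ← Real.exp_add]; ring_nf
    _ = _ := by ring

lemma RapidDecay.add (hc : RapidDecay I c) (hd : RapidDecay I d) :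
    RapidDecay I fun k t => c k t + d k t := by
  intro m
  obtain ⟨C, hC⟩ := hc m
  obtain ⟨D, hD⟩ := hd m
  refine ⟨C + D, fun k t ht => ?_⟩
  have h0 := ord_nonneg k
  have h1 := mul_le_mul_of_nonneg_left (abs_add_le (c k t) (d k t)) (pow_nonneg (by linarith :
    0 ≤ 1 + ord k) m)
  linarith [hC k t ht, hD k t ht]

lemma RapidDecay.const_mul (hc : RapidDecay I c) {p : ℤ × ℤ → ℝ} {K : ℝ} {r : ℕ}
    (hp : ∀ k, |p k| ≤ K * (1 + ord k) ^ r) : RapidDecay I fun k t => p k * c k t := by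
  intro m
  obtain ⟨C, hC⟩ := hc (r + m)
  refine ⟨|K| * C, fun k t ht => ?_⟩
  have h0 := ord_nonneg k
  rw [abs_mul]
  calc (1 + ord k) ^ m * (|p k| * |c k t|)
      ≤ (1 + ord k) ^ m * (|K| * (1 + ord k) ^ r * |c k t|) := by
        have : |p k| ≤ |K| * (1 + ord k) ^ r := (hp k).trans (by gcongr; exact le_abs_self K)
        gcongr
    _ = |K| * ((1 + ord k) ^ (r + m) * |c k t|) := by ring
    _ ≤ |K| * (C * Real.exp (-(1 / 2) * ord k)) :=
        mul_le_mul_of_nonneg_left (hC k t ht) (abs_nonneg K)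
    _ = _ := by ring

lemma RapidDecay.mul_bounded (hc : RapidDecay I c) {E : ℝ → ℝ} (hE : ∀ t ∈ I, |E t| ≤ 1) :
    RapidDecay I fun k t => E t * c k t := by
  intro m
  obtain ⟨C, hC⟩ := hc m
  refine ⟨C, fun k t ht => (mul_le_mul_of_nonneg_left ?_ ?_).trans (hC k t ht)⟩
  · rw [abs_mul]
    exact mul_le_of_le_one_left (abs_nonneg _) (hE t ht)
  · have := ord_nonneg k
    positivity

lemma RapidDecay.shift (hc : RapidDecay I c) {σ : ℤ × ℤ → ℤ × ℤ} (hσ : ∀ k, ord k - 1 ≤ ord (σ k)) :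
    RapidDecay I fun k => c (σ k) := by
  intro m
  obtain ⟨C, hC⟩ := hc m
  refine ⟨2 ^ m * (|C| * Real.exp (1 / 2)), fun k t ht => ?_⟩
  have h0 := ord_nonneg k
  have h1 := ord_nonneg (σ k)
  have h2 := hσ k
  calc (1 + ord k) ^ m * |c (σ k) t| ≤ (2 * (1 + ord (σ k))) ^ m * |c (σ k) t| := by
        gcongr; linarith
    _ = 2 ^ m * ((1 + ord (σ k)) ^ m * |c (σ k) t|) := by rw [mul_pow]; ring
    _ ≤ 2 ^ m * (|C| * Real.exp (1 / 2 + -(1 / 2) * ord k)) := by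
        refine mul_le_mul_of_nonneg_left ((hC (σ k) t ht).trans ?_) (by positivity)
        refine mul_le_mul (le_abs_self C) (Real.exp_le_exp.2 ?_) (Real.exp_pos _).le (abs_nonneg C)
        linarith
    _ = _ := by rw [Real.exp_add]; ring

lemma SmoothDecay.rapidDecay (hc : SmoothDecay I n c) : RapidDecay I c := by
  cases n <;> exact hc.1

lemma SmoothDecay.continuousOn (hc : SmoothDecay I n c) (k : ℤ × ℤ) : ContinuousOn (c k) I := by
  cases n with
  | zero => exact hc.2 k
  | succ n =>
    obtain ⟨-, c', -, h⟩ := hc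
    exact fun t ht => (h k t ht).continuousAt.continuousWithinAt

lemma SmoothDecay.add (hc : SmoothDecay I n c) (hd : SmoothDecay I n d) :
    SmoothDecay I n fun k t => c k t + d k t := by
  induction n generalizing c d with
  | zero => exact ⟨hc.1.add hd.1, fun k => (hc.2 k).add (hd.2 k)⟩
  | succ n ih =>
    obtain ⟨h1, c', h2, h3⟩ := hc
    obtain ⟨k1, d', k2, k3⟩ := hd
    exact ⟨h1.add k1, _, ih h2 k2, fun k t ht => (h3 k t ht).add (k3 k t ht)⟩

lemma SmoothDecay.const_mul (hc : SmoothDecay I n c) {p : ℤ × ℤ → ℝ} {K : ℝ} {r : ℕ}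
    (hp : ∀ k, |p k| ≤ K * (1 + ord k) ^ r) : SmoothDecay I n fun k t => p k * c k t := by
  induction n generalizing c with
  | zero => exact ⟨hc.1.const_mul hp, fun k => (hc.2 k).const_mul (p k)⟩
  | succ n ih =>
    obtain ⟨h1, c', h2, h3⟩ := hc
    exact ⟨h1.const_mul hp, _, ih h2, fun k t ht => (h3 k t ht).const_mul (p k)⟩

lemma SmoothDecay.shift (hc : SmoothDecay I n c) {σ : ℤ × ℤ → ℤ × ℤ}
    (hσ : ∀ k, ord k - 1 ≤ ord (σ k)) : SmoothDecay I n fun k => c (σ k) := by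
  induction n generalizing c with
  | zero => exact ⟨hc.1.shift hσ, fun k => hc.2 (σ k)⟩
  | succ n ih =>
    obtain ⟨h1, c', h2, h3⟩ := hc
    exact ⟨h1.shift hσ, _, ih h2, fun k t ht => h3 (σ k) t ht⟩

lemma SmoothDecay.of_succ (hc : SmoothDecay I (n + 1) c) : SmoothDecay I n c := by
  induction n generalizing c with
  | zero => exact ⟨hc.rapidDecay, hc.continuousOn⟩
  | succ n ih =>
    obtain ⟨h1, c', h2, h3⟩ := hc
    exact ⟨h1, c', ih h2, h3⟩

lemma SmoothDecay.exp_mul (hc : SmoothDecay I n c) {μ : ℝ} (hμ : 0 ≤ μ) (hI : ∀ t ∈ I, 0 ≤ t) :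
    SmoothDecay I n fun k t => Real.exp (-μ * t) * c k t := by
  have hE : ∀ t ∈ I, |Real.exp (-μ * t)| ≤ 1 := fun t ht => by
    rw [Real.abs_exp, Real.exp_le_one_iff]
    nlinarith [hI t ht]
  induction n generalizing c with
  | zero => exact ⟨hc.1.mul_bounded hE, fun k => ContinuousOn.mul (by fun_prop) (hc.2 k)⟩
  | succ n ih =>
    have h0 : SmoothDecay I n c := hc.of_succ
    obtain ⟨h1, c', h2, h3⟩ := hc
    have h4 := (ih h0).const_mul (p := fun _ => -μ) (K := |μ|) (r := 0) (by simp)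
    refine ⟨h1.mul_bounded hE, _, h4.add (ih h2), fun k t ht => ?_⟩
    have h5 : HasDerivAt (fun t : ℝ => Real.exp (-μ * t)) (Real.exp (-μ * t) * (-μ)) t := by
      simpa using ((hasDerivAt_id t).const_mul (-μ)).exp
    convert! h5.mul (h3 k t ht) using 1
    ring

lemma smoothDecay_single (k₀ : ℤ × ℤ) (s : ℝ) :
    SmoothDecay I n fun k _ => if k = k₀ then s else 0 := by
  have hr : ∀ s : ℝ, RapidDecay I fun k _ => if k = k₀ then s else 0 := fun s =>
    rapidDecay_of_exp (C := |s| * Real.exp (ord k₀)) fun k t _ => by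
      split_ifs with h
      · rw [h, mul_assoc, ← Real.exp_add]; simp
      · simp; positivity
  induction n generalizing s with
  | zero => exact ⟨hr s, fun k => continuousOn_const⟩
  | succ n ih =>
    refine ⟨hr s, _, ih 0, fun k t _ => ?_⟩
    simpa using hasDerivAt_const t (if k = k₀ then s else 0)

lemma ord_sub_one_le_left (m : ℤ) (hm : |(m : ℝ)| ≤ 1) (k : ℤ × ℤ) :
    ord k - 1 ≤ ord (k.1 + m, k.2) := by
  have := abs_sub_abs_le_abs_sub (k.1 : ℝ) (-m)
  rw [abs_neg, sub_neg_eq_add] at this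
  simp only [ord, Int.cast_add]
  linarith

lemma ord_sub_one_le_right (m : ℤ) (hm : |(m : ℝ)| ≤ 1) (k : ℤ × ℤ) :
    ord k - 1 ≤ ord (k.1, k.2 + m) := by
  have := abs_sub_abs_le_abs_sub (k.2 : ℝ) (-m)
  rw [abs_neg, sub_neg_eq_add] at this
  simp only [ord, Int.cast_add]
  linarith

lemma SmoothDecay.adv (hc : SmoothDecay I n c) (a b : ℝ) :
    SmoothDecay I n fun k t => adv a b (fun k => c k t) k := by
  have e1 := hc.shift (ord_sub_one_le_left (-1) (by simp))
  have e2 := hc.shift (ord_sub_one_le_left 1 (by simp))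
  have e3 := hc.shift (ord_sub_one_le_right (-1) (by simp))
  have e4 := hc.shift (ord_sub_one_le_right 1 (by simp))
  have p1 : ∀ k : ℤ × ℤ, |-(a * k.2)| ≤ |a| * (1 + ord k) ^ 1 := fun k => by
    rw [abs_neg, abs_mul, pow_one, ord]
    exact mul_le_mul_of_nonneg_left (by linarith [abs_nonneg (k.1 : ℝ)]) (abs_nonneg a)
  have p2 : ∀ k : ℤ × ℤ, |b * k.1| ≤ |b| * (1 + ord k) ^ 1 := fun k => by
    rw [abs_mul, pow_one, ord]
    exact mul_le_mul_of_nonneg_left (by linarith [abs_nonneg (k.2 : ℝ)]) (abs_nonneg b)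
  have neg : ∀ {d : ℤ × ℤ → ℝ → ℝ}, SmoothDecay I n d → SmoothDecay I n fun k t => -1 * d k t :=
    fun hd => hd.const_mul (K := 1) (r := 0) (by simp)
  have h := ((e1.add (neg e2)).const_mul p1).add ((e3.add (neg e4)).const_mul p2)
  convert! h using 3 with k t
  simp only [NSTorus.adv, sub_eq_add_neg]
  ring

/-- A rapidly decaying solution of the lattice system is smooth in time, with all derivatives
rapidly decaying: each time derivative is expressed by the system itself. -/
lemma smoothDecay_of_forcing {a b μ s : ℝ} (hμ : 0 ≤ μ) (hI : ∀ t ∈ I, 0 ≤ t) {l : ℤ × ℤ → ℝ}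
    {K : ℝ} {r : ℕ} (hl : ∀ k, |l k| ≤ K * (1 + ord k) ^ r) (hc : RapidDecay I c)
    (hd : ∀ k, ∀ t ∈ I, HasDerivAt (c k) (-l k * c k t + forcing a b
      (fun t => Real.exp (-μ * t)) (fun t => s * Real.exp (-(2 * μ) * t)) c k t) t) (n : ℕ) :
    SmoothDecay I n c := by
  induction n with
  | zero => exact ⟨hc, fun k t ht => (hd k t ht).continuousAt.continuousWithinAt⟩
  | succ n ih =>
    refine ⟨hc, _, ?_, hd⟩
    have h1 := ih.const_mul (p := fun k => -l k) (K := K) (r := r) (by simpa using hl)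
    have h2 := (ih.adv a b).exp_mul hμ hI
    have h3 := (smoothDecay_single (I := I) (n := n) (1, 1) s).exp_mul
      (mul_nonneg zero_le_two hμ) hI
    convert! h1.add (h2.add h3) using 3 with k t
    simp only [forcing]
    split_ifs <;> ring

end Decay

/-- The series `∑ c k t * sin (⟪κ k, x⟫ + φ)`. -/
def sineSeries (κ : ℤ × ℤ → E3) (φ : ℝ) (c : ℤ × ℤ → ℝ → ℝ) (p : ℝ × E3) : ℝ :=
  ∑' k, c k p.1 * Real.sin (inner ℝ (κ k) p.2 + φ)

section Series

variable {κ : ℤ × ℤ → E3} {W : ℝ} {c : ℤ × ℤ → ℝ → ℝ} {I : Set ℝ}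

lemma RapidDecay.exists_bound (hc : RapidDecay I c) :
    ∃ C, ∀ k, ∀ t ∈ I, |c k t| ≤ C * Real.exp (-(1 / 2) * ord k) := by
  simpa using hc 0

lemma RapidDecay.summable (hc : RapidDecay I c) {t : ℝ} (ht : t ∈ I) {θ : ℤ × ℤ → ℝ}
    (hθ : ∀ k, |θ k| ≤ 1) : Summable fun k => c k t * θ k := by
  obtain ⟨C, hC⟩ := hc.exists_bound
  refine .of_norm_bounded ((summable_exp_neg_mul_ord (r := 1 / 2) (by norm_num)).mul_left C)
    fun k => ?_
  rw [norm_mul]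
  exact (mul_le_of_le_one_right (norm_nonneg _) (hθ k)).trans (hC k t ht)

lemma abs_sineSeries_le {C r : ℝ} (hr : 0 < r) {t : ℝ}
    (hc : ∀ k, |c k t| ≤ C * Real.exp (-r * ord k)) (φ : ℝ) (x : E3) :
    |sineSeries κ φ c (t, x)| ≤ C * ∑' k, Real.exp (-r * ord k) := by
  have hs := (summable_exp_neg_mul_ord hr).mul_left C
  rw [← tsum_mul_left]
  refine tsum_of_norm_bounded (f := fun k => c k t * Real.sin (inner ℝ (κ k) x + φ))
    hs.hasSum fun k => ?_
  rw [norm_mul]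
  exact (mul_le_of_le_one_right (norm_nonneg _) (Real.abs_sin_le_one _)).trans (hc k)

lemma const_mul_wave_bound (hW : ∀ k i, |κ k i| ≤ W * (1 + ord k)) (i : Fin 3) :
    ∀ k, |κ k i| ≤ W * (1 + ord k) ^ 1 := by simpa using fun k => hW k i

/-- Termwise differentiation of a sine series in time and space. -/
lemma hasFDerivAt_sineSeries (hI : IsOpen I) (hIc : Convex ℝ I)
    (hW : ∀ k i, |κ k i| ≤ W * (1 + ord k)) {c' : ℤ × ℤ → ℝ → ℝ} (hc : RapidDecay I c)
    (hc' : RapidDecay I c') (hd : ∀ k, ∀ t ∈ I, HasDerivAt (c k) (c' k t) t) (φ : ℝ)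
    {p : ℝ × E3} (hp : p.1 ∈ I) :
    HasFDerivAt (sineSeries κ φ c)
      (sineSeries κ φ c' p • ContinuousLinearMap.fst ℝ ℝ E3
        + ∑ i, sineSeries κ (φ + Real.pi / 2) (fun k t => κ k i * c k t) p •
          ((EuclideanSpace.proj i : E3 →L[ℝ] ℝ) ∘L ContinuousLinearMap.snd ℝ ℝ E3)) p := by
  have hcw : ∀ i, RapidDecay I fun k t => κ k i * c k t := fun i =>
    hc.const_mul (const_mul_wave_bound hW i)
  let L : Fin 3 → (ℝ × E3 →L[ℝ] ℝ) := fun i =>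
    (EuclideanSpace.proj i : E3 →L[ℝ] ℝ) ∘L ContinuousLinearMap.snd ℝ ℝ E3
  let f' : ℤ × ℤ → ℝ × E3 → (ℝ × E3 →L[ℝ] ℝ) := fun k p =>
    (c' k p.1 * Real.sin (inner ℝ (κ k) p.2 + φ)) • ContinuousLinearMap.fst ℝ ℝ E3
      + ∑ i, (κ k i * c k p.1 * Real.sin (inner ℝ (κ k) p.2 + (φ + Real.pi / 2))) • L i
  have hf : ∀ k, ∀ q ∈ I ×ˢ (univ : Set E3),
      HasFDerivAt (fun q : ℝ × E3 => c k q.1 * Real.sin (inner ℝ (κ k) q.2 + φ)) (f' k q) q := by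
    intro k q hq
    have h1 : HasFDerivAt (fun q : ℝ × E3 => c k q.1)
        (c' k q.1 • ContinuousLinearMap.fst ℝ ℝ E3) q :=
      (hd k q.1 hq.1).comp_hasFDerivAt q hasFDerivAt_fst
    have h2 : HasFDerivAt (fun q : ℝ × E3 => inner ℝ (κ k) q.2 + φ)
        (innerSL ℝ (κ k) ∘L ContinuousLinearMap.snd ℝ ℝ E3) q :=
      ((innerSL ℝ (κ k)).hasFDerivAt.comp q hasFDerivAt_snd).add_const φ
    refine (h1.mul h2.sin).congr_fderiv ?_
    ext v
    · simp [f', L, mul_comm]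
    · simp [f', L, PiLp.inner_apply, Fin.sum_univ_three, ← add_assoc, Real.sin_add_pi_div_two]
      ring
  obtain ⟨C₀, hC₀⟩ := hc.exists_bound
  obtain ⟨C', hC'⟩ := hc'.exists_bound
  choose C hC using fun i => (hcw i).exists_bound
  have hS := summable_exp_neg_mul_ord (r := 1 / 2) (by norm_num)
  have hbd : ∀ k, ∀ q ∈ I ×ˢ (univ : Set E3), ‖f' k q‖ ≤
      C' * Real.exp (-(1 / 2) * ord k) * ‖ContinuousLinearMap.fst ℝ ℝ E3‖
        + ∑ i, C i * Real.exp (-(1 / 2) * ord k) * ‖L i‖ := by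
    intro k q hq
    refine (norm_add_le _ _).trans (add_le_add ?_ ((norm_sum_le _ _).trans
      (Finset.sum_le_sum fun i _ => ?_)))
    · rw [norm_smul, norm_mul]
      exact mul_le_mul_of_nonneg_right ((mul_le_of_le_one_right (norm_nonneg _)
        (Real.abs_sin_le_one _)).trans (hC' k q.1 hq.1)) (norm_nonneg _)
    · rw [norm_smul, norm_mul]
      exact mul_le_mul_of_nonneg_right ((mul_le_of_le_one_right (norm_nonneg _)
        (Real.abs_sin_le_one _)).trans (hC i k q.1 hq.1)) (norm_nonneg _)
  have hsum : Summable fun k => C' * Real.exp (-(1 / 2) * ord k) * ‖ContinuousLinearMap.fst ℝ ℝ E3‖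
        + ∑ i, C i * Real.exp (-(1 / 2) * ord k) * ‖L i‖ :=
    ((hS.mul_left C').mul_right _).add (summable_sum fun i _ => (hS.mul_left (C i)).mul_right _)
  have hsin : ∀ (ψ : ℝ) (k : ℤ × ℤ), |Real.sin (inner ℝ (κ k) p.2 + ψ)| ≤ 1 := fun _ _ =>
    Real.abs_sin_le_one _
  have h := hasFDerivAt_tsum_of_isPreconnected hsum (hI.prod isOpen_univ)
    (hIc.isPreconnected.prod isPreconnected_univ) hf hbd (x := p) (x₀ := p) ⟨hp, mem_univ _⟩
    (hc.summable hp (hsin φ)) ⟨hp, mem_univ _⟩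
  refine h.congr_fderiv ?_
  simp only [f', sineSeries]
  have s1 := hc'.summable hp (hsin φ)
  have s2 := fun i => (hcw i).summable hp (hsin (φ + Real.pi / 2))
  rw [Summable.tsum_add (s1.smul_const _) (summable_sum fun i _ => (s2 i).smul_const _),
    s1.tsum_smul_const, Summable.tsum_finsetSum fun i _ => (s2 i).smul_const _]
  congr 1
  exact Finset.sum_congr rfl fun i _ => (s2 i).tsum_smul_const _

lemma continuousOn_sineSeries (hc : RapidDecay I c) (hcc : ∀ k, ContinuousOn (c k) I) (φ : ℝ) :
    ContinuousOn (sineSeries κ φ c) (I ×ˢ univ) := by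
  obtain ⟨C, hC⟩ := hc.exists_bound
  refine continuousOn_tsum (fun k => ?_)
    ((summable_exp_neg_mul_ord (r := 1 / 2) (by norm_num)).mul_left C) fun k p hp => ?_
  · exact ((hcc k).comp continuousOn_fst fun p hp => hp.1).mul (by fun_prop)
  · rw [norm_mul]
    exact (mul_le_of_le_one_right (norm_nonneg _) (Real.abs_sin_le_one _)).trans (hC k p.1 hp.1)

lemma contDiffOn_sineSeries_nat (hI : IsOpen I) (hIc : Convex ℝ I)
    (hW : ∀ k i, |κ k i| ≤ W * (1 + ord k)) {n : ℕ} (hc : SmoothDecay I n c) (φ : ℝ) :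
    ContDiffOn ℝ n (sineSeries κ φ c) (I ×ˢ univ) := by
  induction n generalizing c φ with
  | zero => exact contDiffOn_zero.2 (continuousOn_sineSeries hc.1 hc.2 φ)
  | succ n ih =>
    have h0 : SmoothDecay I n c := hc.of_succ
    obtain ⟨h1, c', h2, h3⟩ := hc
    have hder := fun p (hp : p ∈ I ×ˢ (univ : Set E3)) =>
      hasFDerivAt_sineSeries hI hIc hW h1 h2.rapidDecay h3 φ hp.1
    rw [Nat.cast_succ, contDiffOn_succ_iff_fderiv_of_isOpen (hI.prod isOpen_univ)]
    refine ⟨fun p hp => (hder p hp).differentiableAt.differentiableWithinAt, by simp, ?_⟩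
    refine ContDiffOn.congr ?_ fun p hp => (hder p hp).fderiv
    refine ((ih h2 φ).smul contDiffOn_const).add (ContDiffOn.sum fun i _ => ?_)
    exact (ih (h0.const_mul (const_mul_wave_bound hW i)) _).smul contDiffOn_const

lemma contDiffOn_sineSeries (hI : IsOpen I) (hIc : Convex ℝ I)
    (hW : ∀ k i, |κ k i| ≤ W * (1 + ord k)) (hc : ∀ n, SmoothDecay I n c) (φ : ℝ) :
    ContDiffOn ℝ ∞ (sineSeries κ φ c) (I ×ˢ univ) :=
  contDiffOn_infty.2 fun n => contDiffOn_sineSeries_nat hI hIc hW (hc n) φ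

end Series

/-! ### The crossing shear flow and its vertical response -/

/-- Wave vector of the background shear. -/
def kBase (N : ℕ) : E3 := !₂[-(N : ℝ), 1, 1]

/-- Wave vector of the perturbation. -/
def kPert (N : ℕ) : E3 := !₂[(N : ℝ), 1, 1]

/-- Direction of the background shear, orthogonal to `kBase`. -/
def dBase (N : ℕ) : E3 := !₂[1, (N : ℝ), 0]

/-- Direction of the perturbation, orthogonal to `kPert`. -/
def dPert (N : ℕ) : E3 := !₂[1, -(N : ℝ), 0]

/-- The direction `kBase × kPert` along which the flow is invariant. -/
def dInv : E3 := !₂[0, 1, -1]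

/-- Superposition of two sine shear flows with wave vectors of equal length. -/
def crossShear (N : ℕ) (A B : ℝ) (x : E3) : E3 :=
  (A * Real.sin (inner ℝ (kBase N) x)) • dBase N + (B * Real.sin (inner ℝ (kPert N) x)) • dPert N

/-- The wave vector `i kBase + j kPert`. -/
def wave (N : ℕ) (k : ℤ × ℤ) : E3 := (k.1 : ℝ) • kBase N + (k.2 : ℝ) • kPert N

lemma inner_wave (N : ℕ) (k : ℤ × ℤ) (x : E3) :
    inner ℝ (wave N k) x = k.1 * inner ℝ (kBase N) x + k.2 * inner ℝ (kPert N) x := by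
  rw [wave, inner_add_left, real_inner_smul_left, real_inner_smul_left]

lemma wave_apply (N : ℕ) (k : ℤ × ℤ) :
    wave N k 0 = N * (k.2 - k.1) ∧ wave N k 1 = k.1 + k.2 ∧ wave N k 2 = k.1 + k.2 := by
  refine ⟨?_, ?_, ?_⟩ <;> simp [wave, kBase, kPert]
  ring

lemma abs_wave_le (N : ℕ) (k : ℤ × ℤ) (i : Fin 3) : |wave N k i| ≤ (N + 1) * (1 + ord k) := by
  obtain ⟨h0, h1, h2⟩ := wave_apply N k
  have hN : (0 : ℝ) ≤ N := N.cast_nonneg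
  have ha := abs_nonneg (k.1 : ℝ)
  have hb := abs_nonneg (k.2 : ℝ)
  have e1 := abs_add_le (k.1 : ℝ) k.2
  have e2 := abs_sub (k.2 : ℝ) k.1
  have e3 := mul_nonneg hN (add_nonneg ha hb)
  fin_cases i
  · simp only [Fin.zero_eta, h0, abs_mul, Nat.abs_cast, ord]
    nlinarith [mul_le_mul_of_nonneg_left e2 hN]
  · simp only [Fin.mk_one, h1, ord]
    nlinarith
  · simp only [Fin.reduceFinMk, h2, ord]
    nlinarith

lemma norm_wave_sq (N : ℕ) (k : ℤ × ℤ) :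
    ‖wave N k‖ ^ 2 = ∑ i, wave N k i * wave N k i := by
  rw [EuclideanSpace.norm_sq_eq]
  exact Finset.sum_congr rfl fun i _ => by rw [Real.norm_eq_abs, sq_abs, sq]

lemma norm_wave_sq_le (N : ℕ) (k : ℤ × ℤ) :
    ‖wave N k‖ ^ 2 ≤ 3 * (N + 1 : ℝ) ^ 2 * (1 + ord k) ^ 2 := by
  have h := fun i => mul_self_le_mul_self (abs_nonneg _) (abs_wave_le N k i)
  simp only [abs_mul_abs_self] at h
  rw [norm_wave_sq, Fin.sum_univ_three]
  have h0 := h 0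
  have h1 := h 1
  have h2 := h 2
  nlinarith

lemma norm_wave_one_one (N : ℕ) : ‖wave N (1, 1)‖ ^ 2 = 8 := by
  obtain ⟨h0, h1, h2⟩ := wave_apply N (1, 1)
  rw [norm_wave_sq, Fin.sum_univ_three, h0, h1, h2]
  norm_num

lemma isPeriodic_inner_of_int {k : E3} (hk : ∀ i, ∃ n : ℤ, k i = n) {F : Type*} {g : ℝ → F}
    (hg : Function.Periodic g (2 * Real.pi)) : IsPeriodic fun x => g (inner ℝ k x) := by
  intro x i
  obtain ⟨n, hn⟩ := hk i
  have h : inner ℝ k ((2 * Real.pi) • e i) = n * (2 * Real.pi) := by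
    rw [real_inner_smul_right, e, EuclideanSpace.inner_single_right]
    simp [hn, mul_comm]
  simp only [inner_add_right, h]
  exact hg.int_mul n _

lemma kBase_int (N : ℕ) (i : Fin 3) : ∃ n : ℤ, kBase N i = n := by
  fin_cases i
  · exact ⟨-N, by simp [kBase]⟩
  · exact ⟨1, by simp [kBase]⟩
  · exact ⟨1, by simp [kBase]⟩

lemma kPert_int (N : ℕ) (i : Fin 3) : ∃ n : ℤ, kPert N i = n := by
  fin_cases i
  · exact ⟨N, by simp [kPert]⟩
  · exact ⟨1, by simp [kPert]⟩
  · exact ⟨1, by simp [kPert]⟩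

lemma wave_int (N : ℕ) (k : ℤ × ℤ) (i : Fin 3) : ∃ n : ℤ, wave N k i = n := by
  obtain ⟨a, ha⟩ := kBase_int N i
  obtain ⟨b, hb⟩ := kPert_int N i
  exact ⟨k.1 * a + k.2 * b, by simp [wave, ha, hb]⟩

/-- The properties of the coefficient `ζ` of `dInv` in the velocity field
`exp (-ν (N² + 2) t) • crossShear N A B + ζ • dInv`. -/
structure IsResponse (ν : ℝ) (N : ℕ) (A B T : ℝ) (ζ : ℝ → E3 → ℝ) : Prop where
  cont : Continuous fun p : ℝ × E3 => ζ p.1 p.2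
  smooth : ContDiffOn ℝ ∞ (fun p : ℝ × E3 => ζ p.1 p.2) (Ioo 0 T ×ˢ univ)
  periodic : ∀ t, IsPeriodic (ζ t)
  initial : ∀ x, ζ 0 x = 0
  invariant : ∀ t ∈ Ioo 0 T, ∀ x, fderiv ℝ (ζ t) x dInv = 0
  bound : ∃ K, ∀ t ∈ Ioo 0 T, ∀ x, ‖fderiv ℝ (ζ t) x‖ ≤ K
  equation : ∀ t ∈ Ioo 0 T, ∀ x, HasDerivAt (fun τ => ζ τ x)
    (ν * Laplacian.laplacian (ζ t) x
      - Real.exp (-(ν * (N ^ 2 + 2)) * t) * fderiv ℝ (ζ t) x (crossShear N A B x)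
      + N ^ 2 * A * B * Real.exp (-(2 * (ν * (N ^ 2 + 2))) * t) *
        Real.sin (inner ℝ (kBase N) x + inner ℝ (kPert N) x)) t

lemma isResponse_zero (ν : ℝ) (N : ℕ) (A T : ℝ) : IsResponse ν N A 0 T fun _ _ => 0 where
  cont := continuous_const
  smooth := contDiffOn_const
  periodic _ _ _ := rfl
  initial _ := rfl
  invariant _ _ _ := by simp
  bound := ⟨0, fun _ _ _ => by simp⟩
  equation t _ x := by simpa using hasDerivAt_const t (0 : ℝ)

section Series

variable {κ : ℤ × ℤ → E3} {c : ℤ × ℤ → ℝ → ℝ} {I : Set ℝ} {W : ℝ}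

lemma SmoothDecay.hasFDerivAt_slice (hI : IsOpen I) (hIc : Convex ℝ I)
    (hW : ∀ k i, |κ k i| ≤ W * (1 + ord k)) (hc : SmoothDecay I 1 c) (φ : ℝ) {t : ℝ} (ht : t ∈ I)
    (x : E3) : HasFDerivAt (fun x => sineSeries κ φ c (t, x))
      (∑ i, sineSeries κ (φ + Real.pi / 2) (fun k t => κ k i * c k t) (t, x) •
          (EuclideanSpace.proj i : E3 →L[ℝ] ℝ)) x := by
  obtain ⟨h1, c', h2, h3⟩ := hc
  have h := (hasFDerivAt_sineSeries hI hIc hW h1 h2.rapidDecay h3 φ (p := (t, x)) ht).comp x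
    (hasFDerivAt_prodMk_right t x)
  refine h.congr_fderiv ?_
  ext v
  simp

lemma SmoothDecay.laplacian_sineSeries (hI : IsOpen I) (hIc : Convex ℝ I)
    (hW : ∀ k i, |κ k i| ≤ W * (1 + ord k)) (hc : ∀ n, SmoothDecay I n c) (φ : ℝ) {t : ℝ}
    (ht : t ∈ I) (x : E3) : Laplacian.laplacian (fun x => sineSeries κ φ c (t, x)) x
      = -∑' k, (∑ i, κ k i * κ k i) * c k t * Real.sin (inner ℝ (κ k) x + φ) := by
  have hs : ContDiff ℝ ∞ fun x => sineSeries κ φ c (t, x) :=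
    contDiffOn_univ.1 ((contDiffOn_sineSeries hI hIc hW hc φ).comp (f := fun x => (t, x))
      (by fun_prop) fun x _ => ⟨ht, mem_univ x⟩)
  have hw : ∀ (i : Fin 3) n, SmoothDecay I n fun k t => κ k i * c k t := fun i n =>
    (hc n).const_mul (const_mul_wave_bound hW i)
  have hww : ∀ (i : Fin 3) n, SmoothDecay I n fun k t => κ k i * (κ k i * c k t) := fun i n =>
    (hw i n).const_mul (const_mul_wave_bound hW i)
  have h1 : ∀ (i : Fin 3) (y : E3), fderiv ℝ (fun x => sineSeries κ φ c (t, x)) y (e i)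
      = sineSeries κ (φ + Real.pi / 2) (fun k t => κ k i * c k t) (t, y) := by
    intro i y
    rw [((hc 1).hasFDerivAt_slice hI hIc hW φ ht y).fderiv]
    fin_cases i <;> simp [Fin.sum_univ_three, e]
  have h2 : ∀ i : Fin 3, fderiv ℝ (fun y => sineSeries κ (φ + Real.pi / 2)
      (fun k t => κ k i * c k t) (t, y)) x (e i)
      = sineSeries κ (φ + Real.pi / 2 + Real.pi / 2) (fun k t => κ k i * (κ k i * c k t))
        (t, x) := by
    intro i
    rw [((hw i 1).hasFDerivAt_slice hI hIc hW (φ + Real.pi / 2) ht x).fderiv]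
    fin_cases i <;> simp [Fin.sum_univ_three, e]
  rw [laplacian_eq_sum (hs.of_le (by norm_cast))]
  simp only [h1, h2]
  simp only [sineSeries]
  rw [← Summable.tsum_finsetSum fun i _ => (hww i 0).rapidDecay.summable ht fun k =>
    Real.abs_sin_le_one _, ← tsum_neg]
  refine tsum_congr fun k => ?_
  rw [show inner ℝ (κ k) x + (φ + Real.pi / 2 + Real.pi / 2) = inner ℝ (κ k) x + φ + Real.pi by
    ring, Real.sin_add_pi, ← Finset.sum_mul]
  simp only [← mul_assoc, ← Finset.sum_mul]
  ring

end Series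

/-- Transport by the crossing shear flow acts on the coefficients of a sine series by `adv`. -/
lemma tsum_adv_mul_sin {I : Set ℝ} {c : ℤ × ℤ → ℝ → ℝ} (hc : RapidDecay I c) (N : ℕ) (A B : ℝ)
    {t : ℝ} (ht : t ∈ I) (x : E3) :
    ∑' k, adv (N * A) (N * B) (fun k => c k t) k * Real.sin (inner ℝ (wave N k) x)
      = -∑ i, sineSeries (wave N) (Real.pi / 2) (fun k t => wave N k i * c k t) (t, x)
        * crossShear N A B x i := by
  set α := inner ℝ (kBase N) x with hα
  set β := inner ℝ (kPert N) x with hβ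
  have hj : RapidDecay I fun k t => (k.2 : ℝ) * c k t :=
    hc.const_mul (K := 1) (r := 1) fun k => by
      rw [one_mul, pow_one, ord]; linarith [abs_nonneg (k.1 : ℝ)]
  have hi : RapidDecay I fun k t => (k.1 : ℝ) * c k t :=
    hc.const_mul (K := 1) (r := 1) fun k => by
      rw [one_mul, pow_one, ord]; linarith [abs_nonneg (k.2 : ℝ)]
  have hw := fun i : Fin 3 => (hc.const_mul (const_mul_wave_bound (abs_wave_le N) i))
  have hθ : ∀ k : ℤ × ℤ, inner ℝ (wave N k) x = k.1 * α + k.2 * β := fun k => inner_wave N k x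
  -- the four neighbour sums, reindexed by the corresponding lattice translation
  have sh : ∀ (v : ℤ × ℤ) {d : ℤ × ℤ → ℝ → ℝ}, RapidDecay I d →
      HasSum (fun k => d (k - v) t * Real.sin (k.1 * α + k.2 * β))
        (∑' k, d k t * Real.sin ((k.1 + v.1) * α + (k.2 + v.2) * β)) := by
    intro v d hd
    have h1 := (hd.summable ht (θ := fun k : ℤ × ℤ => Real.sin ((k.1 + v.1) * α + (k.2 + v.2) * β))
      fun k => Real.abs_sin_le_one _).hasSum
    rw [← (Equiv.subRight v).hasSum_iff] at h1
    refine h1.congr_fun fun k => ?_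
    simp
  have s1 := sh (1, 0) hj
  have s2 := sh (-1, 0) hj
  have s3 := sh (0, 1) hi
  have s4 := sh (0, -1) hi
  have hL := (((s1.sub s2).mul_left (-(N * A))).add ((s3.sub s4).mul_left (N * B))).tsum_eq
  have sj := fun v : ℤ × ℤ => hj.summable ht
    (θ := fun k : ℤ × ℤ => Real.sin ((k.1 + v.1) * α + (k.2 + v.2) * β))
      fun k => Real.abs_sin_le_one _
  have si := fun v : ℤ × ℤ => hi.summable ht
    (θ := fun k : ℤ × ℤ => Real.sin ((k.1 + v.1) * α + (k.2 + v.2) * β))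
      fun k => Real.abs_sin_le_one _
  have hR := ((((sj (1, 0)).hasSum.sub (sj (-1, 0)).hasSum).mul_left (-(N * A))).add
    (((si (0, 1)).hasSum.sub (si (0, -1)).hasSum).mul_left (N * B))).tsum_eq
  have hR2 := (hasSum_sum (s := Finset.univ) fun (i : Fin 3) _ =>
    (((hw i).summable ht (θ := fun k => Real.sin (inner ℝ (wave N k) x + Real.pi / 2))
      fun k => Real.abs_sin_le_one _).hasSum.mul_right (crossShear N A B x i))).neg.tsum_eq
  simp only [sineSeries]
  rw [← hR2]
  trans ∑' k : ℤ × ℤ, (-(N * A) * (((k - (1, 0)).2 : ℝ) * c (k - (1, 0)) t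
        * Real.sin (k.1 * α + k.2 * β)
      - ((k - (-1, 0)).2 : ℝ) * c (k - (-1, 0)) t * Real.sin (k.1 * α + k.2 * β))
      + N * B * (((k - (0, 1)).1 : ℝ) * c (k - (0, 1)) t * Real.sin (k.1 * α + k.2 * β)
      - ((k - (0, -1)).1 : ℝ) * c (k - (0, -1)) t * Real.sin (k.1 * α + k.2 * β)))
  · refine tsum_congr fun k => ?_
    have e1 : k - (1, 0) = (k.1 - 1, k.2) := by ext <;> simp
    have e2 : k - (-1, 0) = (k.1 + 1, k.2) := by ext <;> simp
    have e3 : k - (0, 1) = (k.1, k.2 - 1) := by ext <;> simp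
    have e4 : k - (0, -1) = (k.1, k.2 + 1) := by ext <;> simp
    rw [e1, e2, e3, e4, hθ, adv]
    ring
  rw [hL, ← hR]
  refine tsum_congr fun k => ?_
  obtain ⟨w0, w1, w2⟩ := wave_apply N k
  have u0 : crossShear N A B x 0 = A * Real.sin α + B * Real.sin β := by
    simp [crossShear, dBase, dPert, hα, hβ]
  have u1 : crossShear N A B x 1 = N * (A * Real.sin α - B * Real.sin β) := by
    simp [crossShear, dBase, dPert, hα, hβ]; ring
  have u2 : crossShear N A B x 2 = 0 := by
    simp [crossShear, dBase, dPert]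
  rw [Fin.sum_univ_three, w0, w1, w2, u0, u1, u2, hθ, Real.sin_add_pi_div_two]
  have t1 : Real.sin (((k.1 : ℝ) + ((1 : ℤ) : ℝ)) * α + ((k.2 : ℝ) + ((0 : ℤ) : ℝ)) * β)
      = Real.sin (k.1 * α + k.2 * β) * Real.cos α + Real.cos (k.1 * α + k.2 * β) * Real.sin α := by
    rw [← Real.sin_add]; push_cast; ring_nf
  have t2 : Real.sin (((k.1 : ℝ) + ((-1 : ℤ) : ℝ)) * α + ((k.2 : ℝ) + ((0 : ℤ) : ℝ)) * β)
      = Real.sin (k.1 * α + k.2 * β) * Real.cos α - Real.cos (k.1 * α + k.2 * β) * Real.sin α := by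
    rw [← Real.sin_sub]; push_cast; ring_nf
  have t3 : Real.sin (((k.1 : ℝ) + ((0 : ℤ) : ℝ)) * α + ((k.2 : ℝ) + ((1 : ℤ) : ℝ)) * β)
      = Real.sin (k.1 * α + k.2 * β) * Real.cos β + Real.cos (k.1 * α + k.2 * β) * Real.sin β := by
    rw [← Real.sin_add]; push_cast; ring_nf
  have t4 : Real.sin (((k.1 : ℝ) + ((0 : ℤ) : ℝ)) * α + ((k.2 : ℝ) + ((-1 : ℤ) : ℝ)) * β)
      = Real.sin (k.1 * α + k.2 * β) * Real.cos β - Real.cos (k.1 * α + k.2 * β) * Real.sin β := by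
    rw [← Real.sin_sub]; push_cast; ring_nf
  simp only [t1, t2, t3, t4]
  ring

/-- Existence of the response for short times, and its size: up to a relative error of order
`N A T`, it grows linearly like the plane wave `N² A B t sin (2 (x₂ + x₃))`. -/
theorem exists_isResponse {ν : ℝ} (hν : 0 ≤ ν) (N : ℕ) {A B T : ℝ} (hB : 0 ≤ B) (hBA : B ≤ A)
    (hT : 0 < T) (hq : 2 * (N * A) * Real.exp 2 * T ≤ 1 / 2) :
    ∃ ζ, IsResponse ν N A B T ζ ∧ ∀ t ∈ Icc 0 T, ∃ m : ℝ,
      N ^ 2 * A * B * t * Real.exp (-(8 * ν + 2 * (ν * (N ^ 2 + 2))) * t) ≤ m ∧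
      m ≤ N ^ 2 * A * B * t ∧
      ∀ x, |ζ t x - m * Real.sin (inner ℝ (kBase N) x + inner ℝ (kPert N) x)|
        ≤ 2 * (N * A) * Real.exp 2 * T * (2 * (Real.exp 4 * (N ^ 2 * A * B) * T))
          * ∑' k, Real.exp (-1 * ord k) := by
  have hN : (0 : ℝ) ≤ N := N.cast_nonneg
  have hA : 0 ≤ A := hB.trans hBA
  set μ := ν * (N ^ 2 + 2 : ℝ) with hμdef
  have hμ : 0 ≤ μ := by positivity
  set s := (N : ℝ) ^ 2 * A * B with hsdef
  have hs : 0 ≤ s := by positivity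
  have hexp : ∀ {r t : ℝ}, 0 ≤ r → 0 ≤ t → Real.exp (-r * t) ≤ 1 := fun hr ht => by
    rw [Real.exp_le_one_iff]; nlinarith
  set l : ℤ × ℤ → ℝ := fun k => ν * ‖wave N k‖ ^ 2 with hl
  obtain ⟨c, hcc, hc0, hcb, hcd, hce⟩ := exists_coeff (a := N * A) (b := N * B) (T := T) (S₀ := s)
    (E := fun t => Real.exp (-μ * t)) (S := fun t => s * Real.exp (-(2 * μ) * t)) (l := l)
    (by positivity) (by gcongr) (by fun_prop) (by fun_prop) hT
    (fun t ht => by rw [Real.abs_exp]; exact hexp hμ ht.1)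
    (fun t ht => by
      rw [abs_mul, Real.abs_exp, abs_of_nonneg hs]
      exact mul_le_of_le_one_right hs (hexp (by positivity) ht.1))
    (fun k => by positivity) hq
  have hrd : RapidDecay univ c := rapidDecay_of_exp fun k t _ => hcb k t
  have hrd' : RapidDecay (Ioo 0 T) c := rapidDecay_of_exp fun k t _ => hcb k t
  have hlb : ∀ k, |l k| ≤ ν * (3 * (N + 1 : ℝ) ^ 2) * (1 + ord k) ^ 2 := fun k => by
    rw [hl, abs_of_nonneg (by positivity), mul_assoc]
    exact mul_le_mul_of_nonneg_left (norm_wave_sq_le N k) hν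
  have hsm : ∀ n, SmoothDecay (Ioo 0 T) n c := fun n =>
    smoothDecay_of_forcing hμ (fun t ht => ht.1.le) hlb hrd' hcd n
  have hW := abs_wave_le N
  have hfd := fun (t : ℝ) (ht : t ∈ Ioo 0 T) (x : E3) =>
    ((hsm 1).hasFDerivAt_slice isOpen_Ioo (convex_Ioo 0 T) hW 0 ht x).fderiv
  refine ⟨fun t x => sineSeries (wave N) 0 c (t, x), ⟨?_, ?_, ?_, ?_, ?_, ?_, ?_⟩, ?_⟩
  · exact continuousOn_univ.1 (by
      simpa using continuousOn_sineSeries (κ := wave N) hrd (fun k => (hcc k).continuousOn) 0)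
  · exact contDiffOn_sineSeries isOpen_Ioo (convex_Ioo 0 T) hW hsm 0
  · intro t x i
    refine tsum_congr fun k => ?_
    have h := isPeriodic_inner_of_int (wave_int N k) (g := fun y => Real.sin (y + 0))
      (by simp) x i
    simp only at h ⊢
    rw [h]
  · intro x
    simp [sineSeries, hc0]
  · intro t ht x
    have h12 : sineSeries (wave N) (Real.pi / 2) (fun k t => wave N k 1 * c k t) (t, x)
        = sineSeries (wave N) (Real.pi / 2) (fun k t => wave N k 2 * c k t) (t, x) := by
      simp only [(wave_apply N _).2.1, (wave_apply N _).2.2]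
    rw [hfd t ht x]
    simp [Fin.sum_univ_three, dInv, h12]
  · have hw := fun i : Fin 3 =>
      (hrd'.const_mul (const_mul_wave_bound hW i)).exists_bound
    choose C hC using hw
    refine ⟨∑ i : Fin 3, C i * (∑' k, Real.exp (-(1 / 2) * ord k)) *
      ‖(EuclideanSpace.proj i : E3 →L[ℝ] ℝ)‖, fun t ht x => ?_⟩
    rw [hfd t ht x]
    refine (norm_sum_le _ _).trans (Finset.sum_le_sum fun i _ => ?_)
    rw [norm_smul]
    exact mul_le_mul_of_nonneg_right
      (abs_sineSeries_le (by norm_num) (fun k => hC i k t ht) _ _) (norm_nonneg _)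
  · intro t ht x
    obtain ⟨h1, c', h2, h3⟩ := hsm 1
    have hd := (hasFDerivAt_sineSeries isOpen_Ioo (convex_Ioo 0 T) hW h1 h2.rapidDecay h3 0
      (p := (t, x)) ht).comp_hasDerivAt t ((hasDerivAt_id t).prodMk (hasDerivAt_const t x))
    refine hd.congr_deriv ?_
    have hadv := tsum_adv_mul_sin hrd' N A B ht x
    have hlap := SmoothDecay.laplacian_sineSeries isOpen_Ioo (convex_Ioo 0 T) hW hsm 0 ht x
    have hfdx : fderiv ℝ (fun x => sineSeries (wave N) 0 c (t, x)) x (crossShear N A B x)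
        = -∑' k, adv (N * A) (N * B) (fun k => c k t) k * Real.sin (inner ℝ (wave N k) x) := by
      rw [hfd t ht x, hadv]
      simp
    rw [hfdx, hlap]
    simp only [← norm_wave_sq, add_zero]
    have hc' : ∀ k, c' k t * Real.sin (inner ℝ (wave N k) x)
        = -ν * (‖wave N k‖ ^ 2 * c k t * Real.sin (inner ℝ (wave N k) x))
          + Real.exp (-μ * t) * (adv (N * A) (N * B) (fun k => c k t) k
            * Real.sin (inner ℝ (wave N k) x))
          + (if k = (1, 1) then s * Real.exp (-(2 * μ) * t) else 0)
            * Real.sin (inner ℝ (wave N k) x) := by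
      intro k
      rw [(h3 k t ht).unique (hcd k t ht), forcing, hl]
      ring
    have S1 : Summable fun k => ‖wave N k‖ ^ 2 * c k t * Real.sin (inner ℝ (wave N k) x) :=
      (hrd'.const_mul (p := fun k => ‖wave N k‖ ^ 2) (K := 3 * (N + 1 : ℝ) ^ 2) (r := 2)
        fun k => by
          rw [abs_of_nonneg (by positivity)]; exact norm_wave_sq_le N k).summable ht
        fun k => Real.abs_sin_le_one _
    have S2 : Summable fun k => adv (N * A) (N * B) (fun k => c k t) k
        * Real.sin (inner ℝ (wave N k) x) :=
      ((hsm 0).adv (N * A) (N * B)).rapidDecay.summable ht fun k => Real.abs_sin_le_one _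
    have S3 : HasSum (fun k => (if k = ((1 : ℤ), (1 : ℤ)) then s * Real.exp (-(2 * μ) * t) else 0)
        * Real.sin (inner ℝ (wave N k) x)) (s * Real.exp (-(2 * μ) * t) *
          Real.sin (inner ℝ (wave N (1, 1)) x)) := by
      have := hasSum_ite_eq ((1 : ℤ), (1 : ℤ)) (s * Real.exp (-(2 * μ) * t) *
          Real.sin (inner ℝ (wave N (1, 1)) x))
      refine this.congr_fun fun k => ?_
      split_ifs with h
      · rw [h]
      · simp
    have hsum := ((S1.hasSum.mul_left (-ν)).add (S2.hasSum.mul_left (Real.exp (-μ * t)))).add S3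
    have hser : sineSeries (wave N) 0 c' (t, x)
        = ∑' k, c' k t * Real.sin (inner ℝ (wave N k) x) := by
      simp [sineSeries]
    simp only [add_apply, smul_apply, ContinuousLinearMap.coe_fst', sum_apply,
      ContinuousLinearMap.comp_apply, ContinuousLinearMap.coe_snd']
    rw [hser, tsum_congr hc', hsum.tsum_eq, inner_wave]
    simp
    ring
  · intro t ht
    refine ⟨duhamel (N * A) (N * B) (fun t => Real.exp (-μ * t))
      (fun t => s * Real.exp (-(2 * μ) * t)) l (fun _ _ => 0) (1, 1) t, ?_, ?_, fun x => ?_⟩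
    · have hl11 : l (1, 1) = 8 * ν := by rw [hl]; simp only [norm_wave_one_one]; ring
      simp only [duhamel, forcing, adv, hl11]
      have h1 : ∫ _ in (0 : ℝ)..t, s * Real.exp (-(2 * μ) * t)
          ≤ ∫ τ in (0 : ℝ)..t, Real.exp (8 * ν * τ) * (s * Real.exp (-(2 * μ) * τ)) := by
        refine intervalIntegral.integral_mono_on ht.1 intervalIntegrable_const
          (Continuous.intervalIntegrable (by fun_prop) _ _) fun τ hτ => ?_
        have e1 : 1 ≤ Real.exp (8 * ν * τ) := Real.one_le_exp (by have := hτ.1; positivity)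
        have e2 : Real.exp (-(2 * μ) * t) ≤ Real.exp (-(2 * μ) * τ) :=
          Real.exp_le_exp.2 (by nlinarith [hτ.2])
        calc s * Real.exp (-(2 * μ) * t) ≤ 1 * (s * Real.exp (-(2 * μ) * τ)) := by
              rw [one_mul]; gcongr
          _ ≤ _ := by gcongr
      have h2 := mul_le_mul_of_nonneg_left h1 (Real.exp_pos (-(8 * ν) * t)).le
      rw [intervalIntegral.integral_const] at h2
      refine le_trans (le_of_eq ?_) (h2.trans (le_of_eq ?_))
      · rw [show -(8 * ν + 2 * μ) * t = -(8 * ν) * t + -(2 * μ) * t by ring, Real.exp_add]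
        simp; ring
      · simp
    · have hl11 : l (1, 1) = 8 * ν := by rw [hl]; simp only [norm_wave_one_one]; ring
      simp only [duhamel, forcing, adv, hl11]
      have h1 : ∫ τ in (0 : ℝ)..t, Real.exp (8 * ν * τ) * (s * Real.exp (-(2 * μ) * τ))
          ≤ ∫ _ in (0 : ℝ)..t, Real.exp (8 * ν * t) * s := by
        refine intervalIntegral.integral_mono_on ht.1
          (Continuous.intervalIntegrable (by fun_prop) _ _) intervalIntegrable_const fun τ hτ => ?_
        have e1 : Real.exp (8 * ν * τ) ≤ Real.exp (8 * ν * t) :=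
          Real.exp_le_exp.2 (mul_le_mul_of_nonneg_left hτ.2 (by positivity))
        have e2 : s * Real.exp (-(2 * μ) * τ) ≤ s :=
          mul_le_of_le_one_right hs (hexp (by positivity) hτ.1)
        gcongr
      have h2 := mul_le_mul_of_nonneg_left h1 (Real.exp_pos (-(8 * ν) * t)).le
      rw [intervalIntegral.integral_const] at h2
      refine le_trans (le_of_eq ?_) (h2.trans (le_of_eq ?_))
      · simp
      · have h3 : Real.exp (-(8 * ν) * t) * Real.exp (8 * ν * t) = 1 := by
          rw [← Real.exp_add]; simp
        simp only [sub_zero, smul_eq_mul]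
        linear_combination t * s * h3
    · -- the difference is a sine series whose coefficients are the Duhamel error
      set D := duhamel (N * A) (N * B) (fun t => Real.exp (-μ * t))
        (fun t => s * Real.exp (-(2 * μ) * t)) l (fun _ _ => 0) with hD
      have hD0 : ∀ k, k ≠ (1, 1) → D k t = 0 := fun k hk => by
        simp [hD, duhamel, forcing, adv, hk]
      have hDs : HasSum (fun k => D k t * Real.sin (inner ℝ (wave N k) x + 0))
          (D (1, 1) t * Real.sin (inner ℝ (kBase N) x + inner ℝ (kPert N) x)) := by
        have h := hasSum_single (f := fun k => D k t * Real.sin (inner ℝ (wave N k) x + 0)) (1, 1)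
          fun k hk => by simp only [hD0 k hk, zero_mul]
        simpa [inner_wave] using h
      have hcs : HasSum (fun k => c k t * Real.sin (inner ℝ (wave N k) x + 0))
          (sineSeries (wave N) 0 c (t, x)) :=
        (hrd.summable (mem_univ t) (θ := fun k => Real.sin (inner ℝ (wave N k) x + 0))
          fun k => Real.abs_sin_le_one _).hasSum
      have hdiff : sineSeries (wave N) 0 c (t, x)
          - D (1, 1) t * Real.sin (inner ℝ (kBase N) x + inner ℝ (kPert N) x)
          = sineSeries (wave N) 0 (fun k t => c k t - D k t) (t, x) := by
        rw [← (hcs.sub hDs).tsum_eq]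
        exact tsum_congr fun k => by ring
      rw [hdiff]
      exact abs_sineSeries_le one_pos (fun k => by simpa using hce k t ht) 0 x

/-! ### The exact solution -/

/-- The solution started from `crossShear`. -/
def flow (ν : ℝ) (N : ℕ) (A B : ℝ) (ζ : ℝ → E3 → ℝ) (t : ℝ) (x : E3) : E3 :=
  Real.exp (-(ν * (N ^ 2 + 2)) * t) • crossShear N A B x + ζ t x • dInv

/-- The pressure of the crossing shear flow at time `0`. -/
def shearPressure (N : ℕ) (A B : ℝ) (x : E3) : ℝ :=
  -(A * B) * (N ^ 2 / 2 * Real.cos (inner ℝ (kBase N) x + inner ℝ (kPert N) x)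
    + Real.cos (inner ℝ (kPert N) x - inner ℝ (kBase N) x))

lemma contDiff_crossShear (N : ℕ) (A B : ℝ) : ContDiff ℝ ∞ (crossShear N A B) := by
  have h : ∀ k : E3, ContDiff ℝ ∞ fun x : E3 => Real.sin (inner ℝ k x) := fun k =>
    Real.contDiff_sin.comp (innerSL ℝ k).contDiff
  exact ((contDiff_const.mul (h _)).smul contDiff_const).add
    ((contDiff_const.mul (h _)).smul contDiff_const)

lemma isPeriodic_crossShear (N : ℕ) (A B : ℝ) : IsPeriodic (crossShear N A B) := by
  intro x i
  have h1 := isPeriodic_inner_of_int (kBase_int N) Real.sin_periodic x i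
  have h2 := isPeriodic_inner_of_int (kPert_int N) Real.sin_periodic x i
  simp only [crossShear] at h1 h2 ⊢
  rw [h1, h2]

lemma hasFDerivAt_crossShear (N : ℕ) (A B : ℝ) (x : E3) :
    HasFDerivAt (crossShear N A B)
      ((A * Real.cos (inner ℝ (kBase N) x)) • (innerSL ℝ (kBase N)).smulRight (dBase N)
        + (B * Real.cos (inner ℝ (kPert N) x)) • (innerSL ℝ (kPert N)).smulRight (dPert N)) x := by
  have h : ∀ (a : ℝ) (k d : E3), HasFDerivAt (fun x : E3 => (a * Real.sin (inner ℝ k x)) • d)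
      ((a * Real.cos (inner ℝ k x)) • (innerSL ℝ k).smulRight d) x := fun a k d => by
    refine ((((innerSL ℝ k).hasFDerivAt (x := x)).sin.const_mul a).smul_const d).congr_fderiv ?_
    ext1 v
    simp [smul_smul, mul_assoc]
  exact (h A _ _).add (h B _ _)

lemma laplacian_sin_smul (k d : E3) (a : ℝ) (x : E3) :
    Laplacian.laplacian (fun x : E3 => (a * Real.sin (inner ℝ k x)) • d) x
      = -(‖k‖ ^ 2) • (a * Real.sin (inner ℝ k x)) • d := by
  have hs : ContDiff ℝ ∞ fun x : E3 => (a * Real.sin (inner ℝ k x)) • d :=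
    (contDiff_const.mul (Real.contDiff_sin.comp (innerSL ℝ k).contDiff)).smul contDiff_const
  have h1 : ∀ (i : Fin 3) (y : E3),
      fderiv ℝ (fun x : E3 => (a * Real.sin (inner ℝ k x)) • d) y (e i)
        = (a * k i * Real.cos (inner ℝ k y)) • d := fun i y => by
    have := (((innerSL ℝ k).hasFDerivAt (x := y)).sin.const_mul a).smul_const d
    refine (congrArg (fun L : E3 →L[ℝ] E3 => L (e i)) this.fderiv).trans ?_
    simp [e, EuclideanSpace.inner_single_right, smul_smul]
    ring_nf
  have h2 : ∀ i : Fin 3, fderiv ℝ (fun y : E3 => (a * k i * Real.cos (inner ℝ k y)) • d) x (e i)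
        = -(k i * k i) • (a * Real.sin (inner ℝ k x)) • d := fun i => by
    have := (((innerSL ℝ k).hasFDerivAt (x := x)).cos.const_mul (a * k i)).smul_const d
    refine (congrArg (fun L : E3 →L[ℝ] E3 => L (e i)) this.fderiv).trans ?_
    simp [e, EuclideanSpace.inner_single_right, smul_smul]
    ring_nf
  rw [laplacian_eq_sum (hs.of_le (by norm_cast))]
  simp only [h1, h2, ← Finset.sum_smul, Finset.sum_neg_distrib]
  rw [EuclideanSpace.norm_sq_eq]
  simp only [Real.norm_eq_abs, sq_abs, ← sq]

lemma norm_kBase_sq (N : ℕ) : ‖kBase N‖ ^ 2 = N ^ 2 + 2 := by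
  rw [EuclideanSpace.norm_sq_eq]
  simp [kBase, Fin.sum_univ_three]; ring

lemma norm_kPert_sq (N : ℕ) : ‖kPert N‖ ^ 2 = N ^ 2 + 2 := by
  rw [EuclideanSpace.norm_sq_eq]
  simp [kPert, Fin.sum_univ_three]; ring

lemma laplacian_crossShear (N : ℕ) (A B : ℝ) (x : E3) :
    Laplacian.laplacian (crossShear N A B) x = -(N ^ 2 + 2 : ℝ) • crossShear N A B x := by
  have hs : ∀ (a : ℝ) (k d : E3), ContDiff ℝ 2 fun x : E3 => (a * Real.sin (inner ℝ k x)) • d :=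
    fun a k d =>
      (contDiff_const.mul (Real.contDiff_sin.comp (innerSL ℝ k).contDiff)).smul contDiff_const
  have h := (hs A (kBase N) (dBase N)).contDiffAt.laplacian_add (x := x)
    (hs B (kPert N) (dPert N)).contDiffAt
  refine h.trans ?_
  rw [laplacian_sin_smul, laplacian_sin_smul, norm_kBase_sq, norm_kPert_sq, ← smul_add]
  rfl

lemma gradient_shearPressure (N : ℕ) (A B r : ℝ) (x : E3) :
    gradient (fun x => r * shearPressure N A B x) x
      = (r * (A * B * (N ^ 2 / 2) * Real.sin (inner ℝ (kBase N) x + inner ℝ (kPert N) x)))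
          • (kBase N + kPert N)
        + (r * (A * B * Real.sin (inner ℝ (kPert N) x - inner ℝ (kBase N) x)))
          • (kPert N - kBase N) := by
  have h1 := (innerSL ℝ (kBase N)).hasFDerivAt (x := x)
  have h2 := (innerSL ℝ (kPert N)).hasFDerivAt (x := x)
  have h : HasFDerivAt (fun x => r * shearPressure N A B x) _ x :=
    ((((h1.add h2).cos.const_mul (N ^ 2 / 2 : ℝ)).add (h2.sub h1).cos).const_mul
      (-(A * B))).const_mul r
  rw [gradient, h.fderiv]
  refine ext_inner_right ℝ fun v => ?_
  rw [InnerProductSpace.toDual_symm_apply]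
  simp [inner_add_left, inner_sub_left, real_inner_smul_left]
  ring

section Flow

variable {ν A B T T' : ℝ} {N : ℕ} {ζ : ℝ → E3 → ℝ}

lemma IsResponse.contDiff_slice (hζ : IsResponse ν N A B T' ζ) {t : ℝ} (ht : t ∈ Ioo 0 T') :
    ContDiff ℝ ∞ (ζ t) :=
  contDiffOn_univ.1 (hζ.smooth.comp (f := fun x => (t, x)) (by fun_prop)
    fun x _ => ⟨ht, mem_univ x⟩)

lemma IsResponse.fderiv_flow (hζ : IsResponse ν N A B T' ζ) {t : ℝ} (ht : t ∈ Ioo 0 T') (x : E3) :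
    fderiv ℝ (flow ν N A B ζ t) x = Real.exp (-(ν * (N ^ 2 + 2)) * t) •
      ((A * Real.cos (inner ℝ (kBase N) x)) • (innerSL ℝ (kBase N)).smulRight (dBase N)
        + (B * Real.cos (inner ℝ (kPert N) x)) • (innerSL ℝ (kPert N)).smulRight (dPert N))
      + (fderiv ℝ (ζ t) x).smulRight dInv :=
  (((hasFDerivAt_crossShear N A B x).const_smul (Real.exp (-(ν * (N ^ 2 + 2)) * t))).add
    ((((hζ.contDiff_slice ht).differentiable (by simp)) x).hasFDerivAt.smul_const dInv)).fderiv

lemma IsResponse.exists_bound_fderiv_flow (hζ : IsResponse ν N A B T' ζ) (hν : 0 ≤ ν) :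
    ∃ K, ∀ t ∈ Ioo 0 T', ∀ x, ‖fderiv ℝ (flow ν N A B ζ t) x‖ ≤ K := by
  obtain ⟨K, hK⟩ := hζ.bound
  refine ⟨1 * (|A| * 1 * ‖(innerSL ℝ (kBase N)).smulRight (dBase N)‖
    + |B| * 1 * ‖(innerSL ℝ (kPert N)).smulRight (dPert N)‖) + K * ‖dInv‖, fun t ht x => ?_⟩
  rw [hζ.fderiv_flow ht]
  refine (norm_add_le _ _).trans (add_le_add ?_ ?_)
  · rw [norm_smul, Real.norm_of_nonneg (Real.exp_pos _).le]
    refine mul_le_mul ?_ ((norm_add_le _ _).trans (add_le_add ?_ ?_)) (norm_nonneg _) zero_le_one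
    · rw [Real.exp_le_one_iff]
      have : 0 ≤ ν * ((N : ℝ) ^ 2 + 2) * t := mul_nonneg (by positivity) ht.1.le
      linarith
    · rw [norm_smul, norm_mul, Real.norm_eq_abs, Real.norm_eq_abs]
      gcongr
      exact Real.abs_cos_le_one _
    · rw [norm_smul, norm_mul, Real.norm_eq_abs, Real.norm_eq_abs]
      gcongr
      exact Real.abs_cos_le_one _
  · rw [ContinuousLinearMap.norm_smulRight_apply]
    exact mul_le_mul_of_nonneg_right (hK t ht x) (norm_nonneg _)

/-- The two shears superpose to a steady two-dimensional flow transverse to `dInv`, up to decay, so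
the only uncompensated part of the nonlinearity points along `dInv` and is absorbed by `ζ`. -/
theorem IsResponse.isNSSolution_flow (hζ : IsResponse ν N A B T' ζ) (hTT' : T < T') :
    IsNSSolution ν T (crossShear N A B) (flow ν N A B ζ) := by
  have hsub : Ioc 0 T ⊆ Ioo 0 T' := fun t ht => ⟨ht.1, ht.2.trans_lt hTT'⟩
  have hsmE : ContDiff ℝ ∞ fun p : ℝ × E3 => Real.exp (-(ν * (N ^ 2 + 2)) * p.1) :=
    (contDiff_const.mul contDiff_fst).exp
  refine ⟨?_, ?_, ?_, ?_, ?_, ?_⟩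
  · refine Continuous.continuousOn ?_
    have := (contDiff_crossShear N A B).continuous
    have := hζ.cont
    unfold flow
    fun_prop
  · refine ContDiffOn.add ?_ ((hζ.smooth.mono (prod_mono_left hsub)).smul contDiffOn_const)
    exact (hsmE.smul ((contDiff_crossShear N A B).comp contDiff_snd)).contDiffOn
  · intro t _ x i
    simp only [flow]
    rw [isPeriodic_crossShear N A B x i, hζ.periodic t x i]
  · funext x
    simp [flow, hζ.initial]
  · intro t ht x
    have h := hζ.invariant t (hsub ht) x
    have h2 : fderiv ℝ (ζ t) x (e 1) = fderiv ℝ (ζ t) x (e 2) := by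
      have : dInv = e 1 - e 2 := by ext j; fin_cases j <;> simp [dInv, e]
      rw [this, map_sub] at h
      linarith
    simp only [divergence]
    rw [hζ.fderiv_flow (hsub ht)]
    simp [Fin.sum_univ_three, h2]
    simp [e, EuclideanSpace.inner_single_right, kBase, kPert, dBase, dPert, dInv]
    ring
  · refine ⟨fun t x => Real.exp (-(2 * (ν * (N ^ 2 + 2))) * t) * shearPressure N A B x,
      ?_, ?_, ?_⟩
    · refine ContDiff.contDiffOn ?_
      have h1 := (innerSL ℝ (kBase N)).contDiff (n := ∞)
      have h2 := (innerSL ℝ (kPert N)).contDiff (n := ∞)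
      have h3 : ContDiff ℝ ∞ (shearPressure N A B) :=
        contDiff_const.mul ((contDiff_const.mul (h1.add h2).cos).add (h2.sub h1).cos)
      exact (contDiff_const.mul contDiff_fst).exp.mul (h3.comp contDiff_snd)
    · intro t _ x i
      have h1 := isPeriodic_inner_of_int (k := kBase N + kPert N) (fun i => by
        obtain ⟨a, ha⟩ := kBase_int N i
        obtain ⟨b, hb⟩ := kPert_int N i
        exact ⟨a + b, by simp [ha, hb]⟩) Real.cos_periodic x i
      have h2 := isPeriodic_inner_of_int (k := kPert N - kBase N) (fun i => by
        obtain ⟨a, ha⟩ := kBase_int N i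
        obtain ⟨b, hb⟩ := kPert_int N i
        exact ⟨b - a, by simp [ha, hb]⟩) Real.cos_periodic x i
      simp only [inner_add_left, inner_sub_left] at h1 h2
      simp only [shearPressure]
      rw [h1, h2]
    · intro t ht x
      have htt := hsub ht
      have hsm := hζ.contDiff_slice htt
      have hE : HasDerivAt (fun t : ℝ => Real.exp (-(ν * (N ^ 2 + 2)) * t))
          (Real.exp (-(ν * (N ^ 2 + 2)) * t) * (-(ν * (N ^ 2 + 2)))) t := by
        simpa using ((hasDerivAt_id t).const_mul (-(ν * ((N : ℝ) ^ 2 + 2)))).exp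
      have hd : HasDerivAt (fun τ => flow ν N A B ζ τ x) _ t :=
        (hE.smul_const (crossShear N A B x)).add ((hζ.equation t htt x).smul_const dInv)
      rw [hd.hasDerivWithinAt.derivWithin (uniqueDiffOn_Ioc 0 T t ht), hζ.fderiv_flow htt,
        gradient_shearPressure]
      have hlap : Laplacian.laplacian (flow ν N A B ζ t) x
          = Real.exp (-(ν * (N ^ 2 + 2)) * t) • (-(N ^ 2 + 2 : ℝ) • crossShear N A B x)
            + Laplacian.laplacian (ζ t) x • dInv := by
        have c1 : ContDiffAt ℝ 2 (crossShear N A B) x :=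
          ((contDiff_crossShear N A B).of_le (by norm_cast)).contDiffAt
        have c2 : ContDiffAt ℝ 2 (ζ t) x := (hsm.of_le (by norm_cast)).contDiffAt
        have c3 : ContDiffAt ℝ 2 (fun x => ζ t x • dInv) x := c2.smul contDiffAt_const
        have l1 := (c1.const_smul (Real.exp (-(ν * ((N : ℝ) ^ 2 + 2)) * t))).laplacian_add c3
        have l2 := InnerProductSpace.laplacian_smul
          (Real.exp (-(ν * ((N : ℝ) ^ 2 + 2)) * t)) c1
        have l3 := c2.laplacian_CLM_comp_left
          (l := (ContinuousLinearMap.id ℝ ℝ).smulRight dInv)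
        refine l1.trans ?_
        refine congrArg₂ (· + ·) ?_ l3
        exact l2.trans (by rw [laplacian_crossShear])
      rw [hlap]
      have hζv : fderiv ℝ (ζ t) x (flow ν N A B ζ t x) = Real.exp (-(ν * (N ^ 2 + 2)) * t) *
          fderiv ℝ (ζ t) x (crossShear N A B x) := by
        simp [flow, hζ.invariant t htt x]
      have i1 : inner ℝ (kBase N) (flow ν N A B ζ t x) = Real.exp (-(ν * (N ^ 2 + 2)) * t) *
          (-(2 * N) * (B * Real.sin (inner ℝ (kPert N) x))) := by
        simp only [flow, crossShear, inner_add_right, real_inner_smul_right]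
        simp [kBase, dBase, dPert, dInv, PiLp.inner_apply, Fin.sum_univ_three]
        ring
      have i2 : inner ℝ (kPert N) (flow ν N A B ζ t x) = Real.exp (-(ν * (N ^ 2 + 2)) * t) *
          ((2 * N) * (A * Real.sin (inner ℝ (kBase N) x))) := by
        simp only [flow, crossShear, inner_add_right, real_inner_smul_right]
        simp [kPert, dBase, dPert, dInv, PiLp.inner_apply, Fin.sum_univ_three]
        ring
      have hE2 : Real.exp (-(2 * (ν * (N ^ 2 + 2))) * t)
          = Real.exp (-(ν * (N ^ 2 + 2)) * t) * Real.exp (-(ν * (N ^ 2 + 2)) * t) := by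
        rw [← Real.exp_add]; ring_nf
      simp only [add_apply, smul_apply, ContinuousLinearMap.smulRight_apply, innerSL_apply_apply,
        i1, i2, hζv, hE2, Real.sin_add, Real.sin_sub]
      generalize Real.exp (-(ν * (N ^ 2 + 2)) * t) = E
      generalize fderiv ℝ (ζ t) x (crossShear N A B x) = F
      generalize Laplacian.laplacian (ζ t) x = L
      simp only [crossShear]
      generalize inner ℝ (kBase N) x = α
      generalize inner ℝ (kPert N) x = β
      ext j
      fin_cases j
      · simp [kBase, kPert, dBase, dPert, dInv]; ring
      · simp [kBase, kPert, dBase, dPert, dInv]; ring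
      · simp [kBase, kPert, dBase, dPert, dInv]; ring

theorem IsResponse.isUniqueNSSolution_flow (hζ : IsResponse ν N A B T' ζ) (hTT' : T < T')
    (hν : 0 ≤ ν) : IsUniqueNSSolution ν T (crossShear N A B) (flow ν N A B ζ) := by
  obtain ⟨K, hK⟩ := hζ.exists_bound_fderiv_flow hν
  exact ⟨hζ.isNSSolution_flow hTT', fun w hw => (hζ.isNSSolution_flow hTT').unique hν
    (fun t ht => hK t ⟨ht.1, ht.2.trans hTT'⟩) hw⟩

end Flow

lemma isDatum_crossShear (N : ℕ) (A B : ℝ) : IsDatum (crossShear N A B) where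
  smooth := contDiff_crossShear N A B
  periodic := isPeriodic_crossShear N A B
  meanFree := by
    -- the field is the `x₂` derivative of the corresponding cosines
    have h := integral_cell_sum_fderiv_eq_zero (F := E3)
      (fun i x => if i = 1 then (-A * Real.cos (inner ℝ (kBase N) x)) • dBase N
        + (-B * Real.cos (inner ℝ (kPert N) x)) • dPert N else 0)
      (fun i => by
        have h : ∀ k : E3, ContDiff ℝ 1 fun x : E3 => Real.cos (inner ℝ k x) := fun k =>
          Real.contDiff_cos.comp (innerSL ℝ k).contDiff
        split_ifs
        · exact ((contDiff_const.mul (h _)).smul contDiff_const).add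
            ((contDiff_const.mul (h _)).smul contDiff_const)
        · exact contDiff_const)
      (fun i x j => by
        have h1 := isPeriodic_inner_of_int (kBase_int N) Real.cos_periodic x j
        have h2 := isPeriodic_inner_of_int (kPert_int N) Real.cos_periodic x j
        simp only at h1 h2 ⊢
        rw [h1, h2])
    rw [IsMeanFree, ← h]
    refine integral_congr_ae (ae_of_all _ fun x => ?_)
    have hd : ∀ (a : ℝ) (k d : E3), HasFDerivAt (fun x : E3 => (-a * Real.cos (inner ℝ k x)) • d)
        ((a * Real.sin (inner ℝ k x)) • (innerSL ℝ k).smulRight d) x := fun a k d => by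
      have h1 := ((innerSL ℝ k).hasFDerivAt (x := x)).cos
      refine ((h1.const_mul (-a)).smul_const d).congr_fderiv ?_
      ext1 v
      simp [smul_smul, mul_assoc]
    have hd1 := ((hd A (kBase N) (dBase N)).add (hd B (kPert N) (dPert N))).fderiv
    have hd2 : fderiv ℝ (fun x => (-A * Real.cos (inner ℝ (kBase N) x)) • dBase N
        + (-B * Real.cos (inner ℝ (kPert N) x)) • dPert N) x (e 1) = crossShear N A B x := by
      refine (congrArg (fun L : E3 →L[ℝ] E3 => L (e 1)) hd1).trans ?_
      simp [e, EuclideanSpace.inner_single_right, kBase, kPert, crossShear]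
    beta_reduce
    rw [Fin.sum_univ_three]
    simp only [Fin.isValue, if_true, show ¬ (0 : Fin 3) = 1 by decide,
      show ¬ (2 : Fin 3) = 1 by decide, if_false, hd2]
    simp
  divFree x := by
    simp only [divergence, (hasFDerivAt_crossShear N A B x).fderiv]
    simp [Fin.sum_univ_three]
    simp [e, EuclideanSpace.inner_single_right, kBase, kPert, dBase, dPert]
    ring
  third x := by simp [crossShear, dBase, dPert]

lemma isShearDatum_crossShear (N : ℕ) (A : ℝ) : IsShearDatum (crossShear N A 0) := by
  refine ⟨-N, fun a b => A * Real.sin (a + b), fun _ => 0, ?_, contDiff_const, ?_, ?_, ?_, ?_⟩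
  · exact contDiff_const.mul (contDiff_fst.add contDiff_snd).sin
  · intro a b
    beta_reduce
    rw [show a + 2 * Real.pi + b = a + b + 2 * Real.pi by ring, Real.sin_add_two_pi]
  · intro a b
    beta_reduce
    rw [← add_assoc, Real.sin_add_two_pi]
  · simp
  · intro x
    have h : inner ℝ (kBase N) x = -N * x 0 + x 1 + x 2 := by
      simp [kBase, PiLp.inner_apply, Fin.sum_univ_three]; ring
    ext j
    fin_cases j <;> simp [crossShear, dBase, h]
    ring

/-! ### Size of the solution and choice of parameters -/

lemma flow_apply (ν : ℝ) (N : ℕ) (A B : ℝ) (ζ : ℝ → E3 → ℝ) (t : ℝ) (x : E3) :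
    flow ν N A B ζ t x 0 = Real.exp (-(ν * (N ^ 2 + 2)) * t) *
        (A * Real.sin (inner ℝ (kBase N) x) + B * Real.sin (inner ℝ (kPert N) x)) ∧
    flow ν N A B ζ t x 1 = Real.exp (-(ν * (N ^ 2 + 2)) * t) *
        (N * (A * Real.sin (inner ℝ (kBase N) x) - B * Real.sin (inner ℝ (kPert N) x))) + ζ t x ∧
    flow ν N A B ζ t x 2 = -ζ t x := by
  refine ⟨?_, ?_, ?_⟩ <;> simp [flow, crossShear, dBase, dPert, dInv]
  all_goals ring

lemma crossShear_sub (N : ℕ) (A B : ℝ) (x : E3) :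
    crossShear N A B x - crossShear N A 0 x = Real.sin (inner ℝ (kPert N) x) • (B • dPert N) := by
  simp [crossShear, smul_smul, mul_comm]

lemma horizontal_crossShear_sub (N : ℕ) (A B : ℝ) (x : E3) :
    horizontal (crossShear N A B) x - horizontal (crossShear N A 0) x
      = Real.sin (inner ℝ (kPert N) x) • (B • !₂[1, -(N : ℝ)]) := by
  ext j
  fin_cases j <;> simp [horizontal, crossShear, dBase, dPert] <;> ring

lemma norm_dPert_sq (N : ℕ) : ‖dPert N‖ ^ 2 = 1 + N ^ 2 := by
  rw [EuclideanSpace.norm_sq_eq]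
  simp [dPert, Fin.sum_univ_three]

lemma besovNorm_crossShear_sub (N : ℕ) (A B : ℝ) :
    besovNorm (fun x => crossShear N A B x - crossShear N A 0 x)
      = besovNorm (fun x => horizontal (crossShear N A B) x - horizontal (crossShear N A 0) x) := by
  simp only [crossShear_sub, horizontal_crossShear_sub]
  refine besovNorm_smul_const_congr _ ?_
  rw [norm_smul, norm_smul]
  congr 1
  rw [← sq_eq_sq₀ (norm_nonneg _) (norm_nonneg _), norm_dPert_sq, EuclideanSpace.norm_sq_eq]
  simp [Fin.sum_univ_two]

/-- The factor `‖dPert‖ ≤ ‖kPert‖` shows that a perturbation of velocity `N B` and wave number `N`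
has size `B` in the Besov norm. -/
lemma besovNorm_crossShear_sub_le (N : ℕ) (A : ℝ) {B : ℝ} (hB : 0 ≤ B) :
    besovNorm (fun x => crossShear N A B x - crossShear N A 0 x) ≤ ENNReal.ofReal B := by
  have hk := norm_kPert_sq N
  have hpos : 0 < ‖kPert N‖ := by
    have : 0 < ‖kPert N‖ ^ 2 := by rw [hk]; positivity
    exact lt_of_le_of_ne (norm_nonneg _) fun h => by simp [← h] at this
  simp only [crossShear_sub]
  refine (besovNorm_sin_smul_le (norm_pos_iff.1 hpos) _).trans (ENNReal.ofReal_le_ofReal ?_)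
  rw [div_le_iff₀ hpos, norm_smul, Real.norm_of_nonneg hB]
  refine mul_le_mul_of_nonneg_left ?_ hB
  rw [← sq_le_sq₀ (norm_nonneg _) hpos.le, hk, norm_dPert_sq]
  linarith

lemma half_le_sin {y : ℝ} (h0 : 4 / 5 ≤ y) (h1 : y ≤ 11 / 5) : 1 / 2 ≤ Real.sin y := by
  have hp := Real.pi_gt_d2
  have hp' := Real.pi_lt_d2
  have key : ∀ z, 4 / 5 ≤ z → z ≤ Real.pi / 2 → 1 / 2 ≤ Real.sin z := fun z hz hz' => by
    refine le_trans ?_ (Real.mul_le_sin (by linarith) hz')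
    rw [div_mul_eq_mul_div, le_div_iff₀ Real.pi_pos]
    linarith
  rcases le_total y (Real.pi / 2) with h | h
  · exact key y h0 h
  · rw [← Real.sin_pi_sub]
    exact key _ (by linarith) (by linarith)

/-- A function that is at least `c` in absolute value on a cube of side `r` inside the fundamental
domain has `L³` norm at least `c r`. -/
lemma lt_L3Norm_of_cube {f : E3 → ℝ} {a : Fin 3 → ℝ} {r c K : ℝ} (hr : 0 < r) (ha : ∀ i, 0 ≤ a i)
    (har : ∀ i, a i + r < 2 * Real.pi) (hc : ∀ x ∈ box a (fun i => a i + r), c ≤ |f x|)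
    (hK : K < c * r) (hK0 : 0 ≤ K) : ENNReal.ofReal K < L3Norm f := by
  have hc0 : 0 ≤ c := (pos_of_mul_pos_left (hK0.trans_lt hK) hr.le).le
  refine lt_of_lt_of_le ?_ (ofReal_mul_le_L3Norm (measurableSet_box a fun i => a i + r)
    (fun x hx i => ⟨(ha i).trans (hx i).1, (hx i).2.trans_lt (har i)⟩) hc)
  have hvol : volume (box a fun i => a i + r) ^ (1 / 3 : ℝ) = ENNReal.ofReal r := by
    rw [volume_box]
    simp only [add_sub_cancel_left, Finset.prod_const, Finset.card_univ, Fintype.card_fin]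
    rw [← ENNReal.rpow_natCast, ← ENNReal.rpow_mul]
    norm_num
  rw [hvol, ← ENNReal.ofReal_mul hc0]
  exact (ENNReal.ofReal_lt_ofReal_iff (hK0.trans_lt hK)).2 hK

lemma norm_kBase_add_kPert_sq (N : ℕ) : ‖-(kBase N + kPert N)‖ ^ 2 = 8 := by
  have h := norm_wave_one_one N
  rw [norm_neg]
  simpa [wave] using h

lemma inner_kBase (N : ℕ) (x : E3) : inner ℝ (kBase N) x = -N * x 0 + x 1 + x 2 := by
  simp [kBase, PiLp.inner_apply, Fin.sum_univ_three]; ring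

lemma inner_kPert (N : ℕ) (x : E3) : inner ℝ (kPert N) x = N * x 0 + x 1 + x 2 := by
  simp [kPert, PiLp.inner_apply, Fin.sum_univ_three]; ring

/-- The vertical component has large Besov norm if `ζ` is close to a large plane wave. -/
lemma lt_besovNorm_flow {ν A B T M m : ℝ} {N : ℕ} {ζ : ℝ → E3 → ℝ} (hcont : Continuous (ζ T))
    (hM : 0 < M) (hm : M / 2 ≤ m)
    (hζ : ∀ x, |ζ T x - m * Real.sin (inner ℝ (kBase N) x + inner ℝ (kPert N) x)| ≤ M / 20) :
    ENNReal.ofReal (M / 100) < besovNorm fun x => flow ν N A B ζ T x 2 := by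
  simp only [(flow_apply ν N A B ζ T _).2.2]
  have hh := norm_kBase_add_kPert_sq N
  have h := ofReal_le_besovNorm (f := fun x => -ζ T x) (h := -(kBase N + kPert N)) (m := m)
    (ε := M / 20) (s := 1 / 16) hcont.neg (by intro h0; rw [h0] at hh; simp at hh) (by linarith)
    (fun x => by
      rw [inner_neg_left, Real.sin_neg, inner_add_left, ← abs_neg]
      convert hζ x using 2
      ring) (by norm_num)
  refine lt_of_lt_of_le ?_ h
  rw [hh, show (1 / 16 : ℝ) = (1 / 4) ^ 2 by norm_num, Real.sqrt_sq (by norm_num)]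
  have he : 1 / 2 ≤ Real.exp (-(1 / 4) ^ 2 * 8) := by
    have := Real.add_one_le_exp (-(1 / 4 : ℝ) ^ 2 * 8)
    norm_num at this ⊢
    linarith
  have h1 : M / 2 * (1 / 2) ≤ m * Real.exp (-(1 / 4) ^ 2 * 8) := by gcongr; linarith
  exact (ENNReal.ofReal_lt_ofReal_iff_of_nonneg (by positivity)).2 (by linarith)

/-- All three components have large `L³` norm. -/
lemma lt_L3Norm_flow {ν A B T M m δ : ℝ} {N : ℕ} {ζ : ℝ → E3 → ℝ} (hN : 1 ≤ N) (hδ : 0 < δ)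
    (hM : M = 100 / δ) (hB : 0 ≤ B) (hm : M / 2 ≤ m) (hm' : m ≤ M)
    (hE : 1 / 2 ≤ Real.exp (-(ν * (N ^ 2 + 2)) * T))
    (hA : 4 * M + 40 * N / δ ≤ 3 / 10 * A - B)
    (hζ : ∀ x, |ζ T x - m * Real.sin (inner ℝ (kBase N) x + inner ℝ (kPert N) x)| ≤ M / 20)
    (i : Fin 3) : ENNReal.ofReal (1 / δ) < L3Norm fun x => flow ν N A B ζ T x i := by
  have hM0 : 0 < M := by rw [hM]; positivity
  have hN1 : (1 : ℝ) ≤ N := by exact_mod_cast hN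
  have hpi := Real.pi_gt_three
  have hpi' := Real.pi_lt_d2
  have hζle : ∀ x, |ζ T x| ≤ 2 * M := by
    intro x
    set S := Real.sin (inner ℝ (kBase N) x + inner ℝ (kPert N) x)
    have h1 := hζ x
    have h2 : |m * S| ≤ M := by
      rw [abs_mul, abs_of_nonneg (by linarith)]
      exact (mul_le_of_le_one_right (by linarith) (Real.abs_sin_le_one _)).trans hm'
    linarith [abs_sub_abs_le_abs_sub (ζ T x) (m * S)]
  have hsin : ∀ x, -1 ≤ Real.sin (inner ℝ (kPert N) x) ∧ Real.sin (inner ℝ (kPert N) x) ≤ 1 :=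
    fun x => ⟨Real.neg_one_le_sin _, Real.sin_le_one _⟩
  -- a cube on which the phase of the background shear stays between `7/10` and `1`
  set r : ℝ := 1 / 10 / N with hr
  have hr0 : 0 < r := by positivity
  have hr1 : r ≤ 1 / 10 := div_le_self (by norm_num) hN1
  have hNr : N * r = 1 / 10 := by rw [hr]; field_simp
  set a : Fin 3 → ℝ := ![0, 2 / 5, 2 / 5] with ha
  have ha0 : ∀ i, 0 ≤ a i := by intro i; fin_cases i <;> simp [ha]; all_goals norm_num
  have ha1 : ∀ i, a i + r < 2 * Real.pi := by
    intro i
    have : a i ≤ 2 / 5 := by fin_cases i <;> simp [ha]; all_goals norm_num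
    linarith
  have hα : ∀ x ∈ box a (fun i => a i + r), 3 / 10 ≤ Real.sin (inner ℝ (kBase N) x) := by
    intro x hx
    have h0 := hx 0
    have h1 := hx 1
    have h2 := hx 2
    simp only [ha, mem_Icc, Matrix.cons_val_zero, Matrix.cons_val_one, Matrix.cons_val] at h0 h1 h2
    have h3 : (N : ℝ) * x 0 ≤ N * r := mul_le_mul_of_nonneg_left (by linarith) (by linarith)
    have h4 : 0 ≤ (N : ℝ) * x 0 := mul_nonneg (by linarith) h0.1
    rw [inner_kBase]
    refine le_trans ?_ (Real.mul_le_sin (by linarith) (by linarith))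
    rw [div_mul_eq_mul_div, le_div_iff₀ Real.pi_pos]
    nlinarith
  have hX : ∀ x ∈ box a (fun i => a i + r), 4 * M + 40 * N / δ
      ≤ A * Real.sin (inner ℝ (kBase N) x) - B := by
    intro x hx
    have hA0 : 0 ≤ A := by
      have : 0 ≤ 40 * (N : ℝ) / δ := by positivity
      linarith
    have := mul_le_mul_of_nonneg_left (hα x hx) hA0
    linarith
  have hfin : 1 / δ < 20 * N / δ * r := by
    have : 20 * N / δ * r = 20 * (N * r) / δ := by ring
    rw [this, hNr]
    exact div_lt_div_of_pos_right (by norm_num) hδ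
  have hNδ : 0 < (N : ℝ) / δ := by positivity
  fin_cases i
  · refine lt_L3Norm_of_cube hr0 ha0 ha1 (fun x hx => ?_) hfin (by positivity)
    refine le_trans ?_ (le_abs_self _)
    simp only [Fin.zero_eta, (flow_apply ν N A B ζ T x).1]
    have h1 := hX x hx
    have h2 := mul_le_mul_of_nonneg_left (hsin x).1 hB
    have h3 : 4 * M + 40 * N / δ ≤ A * Real.sin (inner ℝ (kBase N) x)
        + B * Real.sin (inner ℝ (kPert N) x) := by linarith
    have h4 := mul_le_mul hE h3 (by positivity) (Real.exp_pos _).le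
    refine le_trans ?_ h4
    have : 40 * (N : ℝ) / δ = 2 * (20 * N / δ) := by ring
    rw [this]; linarith
  · refine lt_L3Norm_of_cube hr0 ha0 ha1 (fun x hx => ?_) hfin (by positivity)
    refine le_trans ?_ (le_abs_self _)
    simp only [Fin.mk_one, (flow_apply ν N A B ζ T x).2.1]
    have h1 := hX x hx
    have h2 := mul_le_mul_of_nonneg_left (hsin x).2 hB
    have h3 : 1 * (4 * M + 40 * N / δ) ≤ N * (A * Real.sin (inner ℝ (kBase N) x)
        - B * Real.sin (inner ℝ (kPert N) x)) :=
      mul_le_mul hN1 (by linarith) (by positivity) (by linarith)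
    have h4 := mul_le_mul hE h3 (by positivity) (Real.exp_pos _).le
    have h5 := (abs_le.1 (hζle x)).1
    have : 40 * (N : ℝ) / δ = 2 * (20 * N / δ) := by ring
    rw [this] at h4; linarith
  · have hfin2 : 1 / δ < M / 5 * (7 / 20) := by
      rw [hM, div_div, div_mul_div_comm, div_lt_div_iff₀ hδ (by positivity)]
      linarith
    refine lt_L3Norm_of_cube (a := fun _ => 1 / 5) (r := 7 / 20) (by norm_num)
      (fun _ => by norm_num) (fun _ => by linarith) (fun x hx => ?_) hfin2 (by positivity)
    simp only [Fin.reduceFinMk, (flow_apply ν N A B ζ T x).2.2, abs_neg]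
    refine le_trans ?_ (le_abs_self _)
    have h1 := hx 1
    have h2 := hx 2
    simp only [mem_Icc] at h1 h2
    have hs : 1 / 2 ≤ Real.sin (inner ℝ (kBase N) x + inner ℝ (kPert N) x) := by
      rw [inner_kBase, inner_kPert]
      exact half_le_sin (by linarith) (by linarith)
    have h3 := mul_le_mul_of_nonneg_left hs (by linarith : 0 ≤ m)
    have h4 := (abs_le.1 (hζ x)).1
    linarith

/-- The amplitude of the vertical plane wave is `N² A B T = 100 / δ`. The wave number `N` is chosen
first, to make the relative error `N A T = 100 / (δ N B)` small; then `T` is taken small, that is,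
`A` large, to make viscosity negligible. -/
lemma exists_parameters {ν δ : ℝ} (hν : 0 < ν) (hδ : 0 < δ) {Z : ℝ} (hZ : 0 ≤ Z) :
    ∃ (N : ℕ) (A T : ℝ), 1 ≤ N ∧ 0 < T ∧ T < δ ∧ N ^ 2 * A * (δ / 2) * T = 100 / δ ∧
      δ / 2 ≤ A ∧ 2 * (N * A) * Real.exp 2 * (2 * T) ≤ 1 / 2 ∧
      2 * (N * A) * Real.exp 2 * (2 * T) *
        (2 * (Real.exp 4 * (N ^ 2 * A * (δ / 2)) * (2 * T))) * Z ≤ 100 / δ / 20 ∧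
      (8 * ν + 2 * (ν * (N ^ 2 + 2))) * T ≤ 1 / 2 ∧
      4 * (100 / δ) + 40 * N / δ ≤ 3 / 10 * A - δ / 2 := by
  set M := 100 / δ with hM
  have hM0 : 0 < M := by positivity
  obtain ⟨N, hN⟩ := exists_nat_ge (1 + 8 * Real.exp 2 * M / (δ / 2)
    + 320 * Real.exp 2 * Real.exp 4 * M * Z / (δ / 2))
  have hN1 : (1 : ℝ) ≤ N := le_trans (by
    have : 0 ≤ 8 * Real.exp 2 * M / (δ / 2) := by positivity
    have : 0 ≤ 320 * Real.exp 2 * Real.exp 4 * M * Z / (δ / 2) := by positivity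
    linarith) hN
  have hN0 : (0 : ℝ) < N := by linarith
  set X := 4 * M + 40 * N / δ + δ / 2 with hX
  have hX0 : 0 < X := by positivity
  set T := min (δ / 2) (min (1 / 2 / (8 * ν + 2 * (ν * (N ^ 2 + 2))))
    (3 / 10 * M / (N ^ 2 * (δ / 2) * X))) with hT
  have hT0 : 0 < T := by
    simp only [hT, lt_min_iff]
    refine ⟨by positivity, by positivity, by positivity⟩
  have hT1 : T ≤ δ / 2 := min_le_left _ _
  have hT2 : T ≤ 1 / 2 / (8 * ν + 2 * (ν * (N ^ 2 + 2))) :=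
    (min_le_right _ _).trans (min_le_left _ _)
  have hT3 : T ≤ 3 / 10 * M / (N ^ 2 * (δ / 2) * X) :=
    (min_le_right _ _).trans (min_le_right _ _)
  set A := M / (N ^ 2 * (δ / 2) * T) with hA
  have hA0 : 0 < A := by positivity
  have hAX : X ≤ 3 / 10 * A := by
    rw [le_div_iff₀ (by positivity)] at hT3
    rw [hA, ← mul_div_assoc, le_div_iff₀ (by positivity)]
    linarith
  have hampl : N ^ 2 * A * (δ / 2) * T = M := by rw [hA]; field_simp
  have hNAT : N * A * T = M / (N * (δ / 2)) := by rw [hA]; field_simp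
  have hN2 : 8 * Real.exp 2 * M ≤ N * (δ / 2) := by
    rw [← div_le_iff₀ (by positivity)]
    have : 0 ≤ 320 * Real.exp 2 * Real.exp 4 * M * Z / (δ / 2) := by positivity
    linarith
  have hN3 : 320 * Real.exp 2 * Real.exp 4 * M * Z ≤ N * (δ / 2) := by
    rw [← div_le_iff₀ (by positivity)]
    have : 0 ≤ 8 * Real.exp 2 * M / (δ / 2) := by positivity
    linarith
  refine ⟨N, A, T, by exact_mod_cast hN1, hT0, by linarith, hampl, ?_, ?_, ?_, ?_, ?_⟩
  · have : δ / 2 ≤ X := by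
      have : 0 ≤ 40 * (N : ℝ) / δ := by positivity
      linarith
    linarith
  · have h1 : 2 * (N * A) * Real.exp 2 * (2 * T) = 4 * Real.exp 2 * (N * A * T) := by ring
    rw [h1, hNAT, ← mul_div_assoc, div_le_iff₀ (by positivity)]
    linarith
  · have h1 : 2 * (N * A) * Real.exp 2 * (2 * T) *
        (2 * (Real.exp 4 * (N ^ 2 * A * (δ / 2)) * (2 * T))) * Z
        = 16 * Real.exp 2 * Real.exp 4 * Z * (N ^ 2 * A * (δ / 2) * T) * (N * A * T) := by ring
    rw [h1, hNAT, hampl, ← mul_div_assoc, div_le_iff₀ (by positivity)]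
    nlinarith
  · rwa [le_div_iff₀ (by positivity), mul_comm] at hT2
  · linarith

end NSTorus

end

theorem theoremA (ν : ℝ) (hν : 0 < ν) (δ : ℝ) (hδ0 : 0 < δ) (hδ1 : δ < 1) :
    ∃ uin ubin : NSTorus.E3 → NSTorus.E3,
      NSTorus.IsDatum uin ∧ NSTorus.IsDatum ubin ∧ NSTorus.IsShearDatum ubin ∧
      NSTorus.besovNorm (fun x => uin x - ubin x) =
        NSTorus.besovNorm (fun x => NSTorus.horizontal uin x - NSTorus.horizontal ubin x) ∧
      NSTorus.besovNorm (fun x => uin x - ubin x) < ENNReal.ofReal δ ∧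
      ∃ T : ℝ, 0 < T ∧ T < δ ∧
        ∃ u ub : ℝ → NSTorus.E3 → NSTorus.E3,
          NSTorus.IsUniqueNSSolution ν T uin u ∧
          NSTorus.IsUniqueNSSolution ν T ubin ub ∧
          (∀ t ∈ Set.Icc 0 T, ∀ x, ub t x 2 = 0) ∧
          NSTorus.besovNorm (fun x => u T x 2 - ub T x 2) =
            NSTorus.besovNorm (fun x => u T x 2) ∧
          ENNReal.ofReal (1 / δ) < NSTorus.besovNorm (fun x => u T x 2) ∧
          ∀ i : Fin 3, ENNReal.ofReal (1 / δ) < NSTorus.L3Norm (fun x => u T x i) := by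
  obtain ⟨N, A, T, hN, hT0, hTδ, hampl, hBA, hq, herr, hvisc, hA⟩ :=
    NSTorus.exists_parameters hν hδ0 (Z := ∑' k, Real.exp (-1 * NSTorus.ord k))
      (tsum_nonneg fun _ => (Real.exp_pos _).le)
  have hM0 : 0 < 100 / δ := by positivity
  obtain ⟨ζ, hζ, hsize⟩ := NSTorus.exists_isResponse hν.le N (by positivity) hBA
    (by positivity : 0 < 2 * T) hq
  obtain ⟨m, hm, hm', hclose⟩ := hsize T ⟨hT0.le, by linarith⟩
  rw [hampl] at hm hm'
  have hclose' := fun x => (hclose x).trans herr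
  have hμ : 0 ≤ ν * ((N : ℝ) ^ 2 + 2) * T := by positivity
  have hνT : 0 ≤ ν * T := by positivity
  have hmM : 100 / δ / 2 ≤ m := by
    refine le_trans ?_ hm
    have h1 := Real.add_one_le_exp (-(8 * ν + 2 * (ν * ((N : ℝ) ^ 2 + 2))) * T)
    rw [div_eq_mul_one_div (100 / δ) 2]
    refine mul_le_mul_of_nonneg_left ?_ hM0.le
    linarith
  have hE : 1 / 2 ≤ Real.exp (-(ν * ((N : ℝ) ^ 2 + 2)) * T) := by
    have h1 := Real.add_one_le_exp (-(ν * ((N : ℝ) ^ 2 + 2)) * T)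
    linarith
  have hub2 : ∀ t x, NSTorus.flow ν N A 0 (fun _ _ => 0) t x 2 = 0 := fun t x => by
    rw [(NSTorus.flow_apply ν N A 0 (fun _ _ => 0) t x).2.2, neg_zero]
  refine ⟨NSTorus.crossShear N A (δ / 2), NSTorus.crossShear N A 0,
    NSTorus.isDatum_crossShear N A _, NSTorus.isDatum_crossShear N A 0,
    NSTorus.isShearDatum_crossShear N A, NSTorus.besovNorm_crossShear_sub N A _, ?_,
    T, hT0, hTδ, NSTorus.flow ν N A (δ / 2) ζ, NSTorus.flow ν N A 0 fun _ _ => 0,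
    hζ.isUniqueNSSolution_flow (by linarith) hν.le,
    (NSTorus.isResponse_zero ν N A (2 * T)).isUniqueNSSolution_flow (by linarith) hν.le,
    fun t _ x => hub2 t x, ?_, ?_, ?_⟩
  · exact (NSTorus.besovNorm_crossShear_sub_le N A (by positivity)).trans_lt
      ((ENNReal.ofReal_lt_ofReal_iff hδ0).2 (by linarith))
  · simp only [hub2, sub_zero]
  · have hcont : Continuous (ζ T) :=
      hζ.cont.comp (Continuous.prodMk continuous_const continuous_id)
    have h := NSTorus.lt_besovNorm_flow (ν := ν) (A := A) (B := δ / 2) hcont hM0 hmM hclose'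
    rwa [show 100 / δ / 100 = 1 / δ by ring] at h
  · exact NSTorus.lt_L3Norm_flow hN hδ0 rfl (by positivity) hmM hm' hE hA hclose'
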